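/- Let $n_1,n_2,k_1,k_2\ge 1$ and $D\ge 1$ be integers, let $\lambda\in\mathbb{R}$ and $0<r<1$. Write $a\wedge b=\min(a,b)$. Let the labels $(z_1)_i$, $1\le i\le n_1$, and $(z_2)_j$, $1\le j\le n_2$, be independent and uniformly distributed on $\{1,\dots,k_1\wedge k_2\}$, and let $M\in\mathbb{R}^{n_1\times n_2}$ be the random matrix with entries $M_{ij}=\lambda\,\mathbf{1}\big((z_1)_i=(z_2)_j\big)$. Denote the law of $M$ by $\mathbb{P}_{\mathrm{BC}(\lambda)}$. Observe $Y=M+E$, where $E\in\mathbb{R}^{n_1\times n_2}$ is independent of $M$ and has i.i.d. $N(0,1)$ entries. For $\widehat M\in\mathbb{R}^{n_1\times n_2}$ put $\ell(\widehat M,M)=\frac{1}{n_1n_2}\sum_{i=1}^{n_1}\sum_{j=1}^{n_2}(\widehat M_{ij}-M_{ij})^2$, and let $\mathbb{R}[Y]_{\le D}^{n_1\times n_2}$ be the set of estimators $\widehat M=\widehat M(Y)$ each of whose entries is a real polynomial of total degree at most $D$ in the entries of $Y$. If $$\lambda^2\le\frac{r}{(D(D+1))^2}\min\left(1,\frac{k_1^2\wedge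 k_2^2}{n_1+n_2}\right),$$ then $$\inf_{\widehat M\in\mathbb{R}[Y]_{\le D}^{n_1\times n_2}}\mathbb{E}_{Y,\,M\sim\mathbb{P}_{\mathrm{BC}(\lambda)}}\big(\ell(\widehat M,M)\big)\ \ge\ \frac{\lambda^2}{k_1\wedge k_2}-\left(\frac{\lambda^2}{k_1^2\wedge k_2^2}+\frac{r(2-r)\lambda^2}{(1-r)^2(n_1+n_2)}\right).$$ -/

import Mathlib

open MeasureTheory ProbabilityTheory

noncomputable section

/-- Real `n₁ × n₂` matrices, as families indexed by pairs (row, column). -/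
abbrev RealMat (n₁ n₂ : ℕ) : Type := Fin n₁ × Fin n₂ → ℝ

/-- The uniform distribution on `{1, …, k}` (a probability measure when `k ≥ 1`). -/
def unifLabel (k : ℕ) : Measure (Fin k) := uniformOn Set.univ

/-- The law of the pair of label vectors `(z₁, z₂)`: all the labels `(z₁)_i`, `i ∈ [n₁]`, and
`(z₂)_j`, `j ∈ [n₂]`, are independent and uniform on `{1, …, k₁ ∧ k₂}`. -/
def labelLaw (n₁ n₂ k₁ k₂ : ℕ) :
    Measure ((Fin n₁ → Fin (min k₁ k₂)) × (Fin n₂ → Fin (min k₁ k₂))) :=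
  (Measure.pi fun _ : Fin n₁ => unifLabel (min k₁ k₂)).prod
    (Measure.pi fun _ : Fin n₂ => unifLabel (min k₁ k₂))

/-- The signal matrix `M_{ij} = lam · 1((z₁)_i = (z₂)_j)`. -/
def signal {n₁ n₂ k : ℕ} (lam : ℝ) (z : (Fin n₁ → Fin k) × (Fin n₂ → Fin k)) : RealMat n₁ n₂ :=
  fun ij => if z.1 ij.1 = z.2 ij.2 then lam else 0

/-- The biclustering prior: the law of the signal matrix `M`. -/
def biclusterPrior (n₁ n₂ k₁ k₂ : ℕ) (lam : ℝ) : Measure (RealMat n₁ n₂) :=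
  (labelLaw n₁ n₂ k₁ k₂).map (signal lam)

/-- The noise: a matrix `E` with i.i.d. `N(0, 1)` entries. -/
def noiseLaw (n₁ n₂ : ℕ) : Measure (RealMat n₁ n₂) :=
  Measure.pi fun _ => gaussianReal 0 1

/-- The loss `ℓ(A, M) = (1 / (n₁ n₂)) ∑_{i, j} (A_{ij} - M_{ij})²`. -/
def loss {n₁ n₂ : ℕ} (A M : RealMat n₁ n₂) : ℝ :=
  1 / ((n₁ : ℝ) * (n₂ : ℝ)) * ∑ i, ∑ j, (A (i, j) - M (i, j)) ^ 2

/-- Matrix-valued estimators all of whose entries are real polynomials of total degree at most `D`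
in the entries of the observed matrix `Y`. -/
def LowDegEstimator (n₁ n₂ D : ℕ) : Type :=
  {P : Fin n₁ × Fin n₂ → MvPolynomial (Fin n₁ × Fin n₂) ℝ // ∀ ij, (P ij).totalDegree ≤ D}

/-- The estimate computed from the observation `Y`. -/
def LowDegEstimator.estimate {n₁ n₂ D : ℕ} (P : LowDegEstimator n₁ n₂ D) (Y : RealMat n₁ n₂) :
    RealMat n₁ n₂ :=
  fun ij => MvPolynomial.eval Y (P.1 ij)

/-- The Bayes risk `𝔼 ℓ(M̂(Y), M)` of an estimator `M̂`, where `Y = M + E`, `M` is drawn from the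
biclustering prior and `E` is Gaussian noise independent of `M`. -/
def bayesRisk {n₁ n₂ D : ℕ} (k₁ k₂ : ℕ) (lam : ℝ) (P : LowDegEstimator n₁ n₂ D) : ℝ :=
  ∫ ME : RealMat n₁ n₂ × RealMat n₁ n₂, loss (P.estimate (ME.1 + ME.2)) ME.1
    ∂((biclusterPrior n₁ n₂ k₁ k₂ lam).prod (noiseLaw n₁ n₂))

/-- The infimum of the Bayes risk over all the estimators of degree at most `D`. -/
def lowDegBayesRisk (n₁ n₂ k₁ k₂ D : ℕ) (lam : ℝ) : ℝ :=
  ⨅ P : LowDegEstimator n₁ n₂ D, bayesRisk k₁ k₂ lam P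

/-- The infimum is over a nonempty family. -/
instance instNonemptyLowDegEstimator (n₁ n₂ D : ℕ) : Nonempty (LowDegEstimator n₁ n₂ D) :=
  ⟨⟨fun _ => 0, fun _ => by simp⟩⟩

/-- The infimum is over a family that is bounded below. -/
theorem bddBelow_bayesRisk (n₁ n₂ k₁ k₂ D : ℕ) (lam : ℝ) :
    BddBelow (Set.range fun P : LowDegEstimator n₁ n₂ D => bayesRisk k₁ k₂ lam P) := by
  refine ⟨0, ?_⟩
  rintro _ ⟨P, rfl⟩
  exact integral_nonneg fun _ => by unfold loss; positivity

end

/-! Let x be one entry of the signal X, let Z be the Gaussian noise and P a polynomial of degree at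
most D. Write a_β(X) for the β-th Hermite coefficient of z ↦ P(X + z). Orthogonality and Jensen give
𝔼 P² = ∑ β! 𝔼 a_β² ≥ ∑ (𝔼 a_β)². The addition formula for Hermite polynomials gives 𝔼 xP = 𝔼 x a_0 =
∑ κ_β 𝔼 a_β, where κ_β is the joint cumulant of x and of the entries of X repeated according to β.
Completing squares, the risk is at least 𝔼 x² − ∑ κ_α² over |α| ≤ D
(`le_expect_integral_sq_of_cumulants`).

Put k = k₁ ∧ k₂ and n = n₁ + n₂. A multi-index α is a bipartite multigraph on rows and columns, and
κ_α is lam^(|α|+1) times a cumulant of indicators that edges are monochromatic. For α ≠ 0,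
independence makes it vanish unless the multigraph is connected and covers the marked row and column
(`mem_of_cumulant_ne_zero`); then it has v < |α| unmarked vertices (`card_reducedSupport_le`). An
induction over sub-multigraphs bounds the indicator cumulant by k^-(v+1) (|α|+1)^|α|
(`abs_cumulant_le`).

With d = |α|, the signal-to-noise condition turns this into κ_α² ≤ (lam²/n) r^d d^(-2d) n^(-v).
There are at most n^v sets of v unmarked vertices and at most d^(2d) multigraphs on each, so degree
d contributes at most (lam²/n) d r^d, while α = 0 contributes at most lam²/k². Summing over d gives
`sum_sq_cumulant_le`. -/

open scoped BigOperators

/-! ### Hermite polynomials and the Gaussian measure in one variable. -/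

/-- The probabilists' Hermite polynomials, with real coefficients. -/
noncomputable def realHermite (n : ℕ) : Polynomial ℝ :=
  (Polynomial.hermite n).map (Int.castRingHom ℝ)

theorem realHermite_zero : realHermite 0 = 1 := by
  simp [realHermite]

theorem realHermite_succ (n : ℕ) :
    realHermite (n + 1) =
      Polynomial.X * realHermite n - Polynomial.derivative (realHermite n) := by
  simp [realHermite, Polynomial.hermite_succ, Polynomial.derivative_map]

theorem derivative_realHermite_succ (n : ℕ) :
    Polynomial.derivative (realHermite (n + 1)) = Polynomial.C ((n : ℝ) + 1) * realHermite n := by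
  induction n with
  | zero => simp [realHermite_succ, realHermite_zero]
  | succ n ih =>
    rw [realHermite_succ (n + 1), ih]
    simp only [Polynomial.derivative_sub, Polynomial.derivative_mul, Polynomial.derivative_X, ih,
      Polynomial.derivative_C]
    rw [realHermite_succ n]
    push_cast
    simp only [Polynomial.C_add, Polynomial.C_1]
    ring

/-- As functions of x the two sides have the same derivative, by induction and
`derivative_realHermite_succ`, and they agree at x = 0. -/
theorem eval_realHermite_add (n : ℕ) (x y : ℝ) :
    (realHermite n).eval (x + y) =
      ∑ j ∈ Finset.range (n + 1), (n.choose j : ℝ) * x ^ (n - j) * (realHermite j).eval y := by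
  induction n generalizing x y with
  | zero => simp [realHermite_zero]
  | succ n ih =>
    set F : ℝ → ℝ := fun x => (realHermite (n + 1)).eval (x + y) -
      ∑ j ∈ Finset.range (n + 1 + 1),
        ((n + 1).choose j : ℝ) * x ^ (n + 1 - j) * (realHermite j).eval y with hF
    have hd : ∀ x, HasDerivAt F 0 x := by
      intro x
      have h1 : HasDerivAt (fun x : ℝ => (realHermite (n + 1)).eval (x + y))
          (((n : ℝ) + 1) * (realHermite n).eval (x + y)) x := by
        have := ((realHermite (n + 1)).hasDerivAt (x + y)).comp_add_const x y
        simpa [derivative_realHermite_succ] using this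
      have h2 : HasDerivAt (fun x : ℝ => ∑ j ∈ Finset.range (n + 1 + 1),
          ((n + 1).choose j : ℝ) * x ^ (n + 1 - j) * (realHermite j).eval y)
          (∑ j ∈ Finset.range (n + 1 + 1), ((n + 1).choose j : ℝ) *
            (((n + 1 - j : ℕ) : ℝ) * x ^ (n + 1 - j - 1)) * (realHermite j).eval y) x :=
        HasDerivAt.fun_sum fun j _ =>
          ((hasDerivAt_pow (n + 1 - j) x).const_mul _).mul_const _
      refine (h1.sub (h2.congr_deriv ?_)).congr_deriv (sub_self _)
      rw [Finset.sum_range_succ, ih, Finset.mul_sum]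
      simp only [Nat.sub_self, Nat.cast_zero, zero_mul, mul_zero, add_zero]
      refine Finset.sum_congr rfl fun j hj => ?_
      have hj : j ≤ n := by simpa [Nat.lt_succ_iff] using hj
      have h3 : ((n + 1).choose j : ℝ) * ((n + 1 - j : ℕ) : ℝ) =
          ((n : ℝ) + 1) * (n.choose j : ℝ) := by
        have := Nat.choose_mul_succ_eq n j
        rw [mul_comm] at this
        exact_mod_cast this.symm
      rw [show n + 1 - j - 1 = n - j by lia]
      linear_combination (x ^ (n - j) * (realHermite j).eval y) * h3
    have hconst := is_const_of_deriv_eq_zero (fun x => (hd x).differentiableAt)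
      (fun x => (hd x).deriv) x 0
    have h0 : F 0 = 0 := by
      simp only [hF, zero_add]
      rw [Finset.sum_range_succ, Finset.sum_eq_zero]
      · simp
      · intro j hj
        rw [zero_pow]
        · simp
        · have := Finset.mem_range.1 hj
          lia
    rw [h0] at hconst
    exact sub_eq_zero.1 hconst

theorem integrable_eval_gaussianReal (p : Polynomial ℝ) :
    Integrable (fun x => p.eval x) (gaussianReal 0 1) := by
  induction p using Polynomial.induction_on' with
  | add p q hp hq => exact (hp.add hq).congr (ae_of_all _ fun x => by simp)
  | monomial n a =>
    simp only [Polynomial.eval_monomial]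
    refine Integrable.const_mul ?_ a
    have h := (memLp_id_gaussianReal' (μ := 0) (v := 1) n (by simp)).integrable_norm_pow'
    refine h.mono (by fun_prop) (ae_of_all _ fun x => by simp)

/-- Stein's identity: integration by parts against the density φ, which satisfies φ' = -xφ. -/
theorem integral_X_mul_gaussianReal (p : Polynomial ℝ) :
    ∫ x, x * p.eval x ∂gaussianReal 0 1 = ∫ x, p.derivative.eval x ∂gaussianReal 0 1 := by
  have hI : ∀ q : Polynomial ℝ, Integrable (fun x => q.eval x * gaussianPDFReal 0 1 x) := by
    intro q
    have h := integrable_eval_gaussianReal q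
    rw [gaussianReal_of_var_ne_zero _ one_ne_zero,
      integrable_withDensity_iff (measurable_gaussianPDF 0 1) (by simp [gaussianPDF_lt_top])] at h
    simpa using h
  have hd : ∀ x : ℝ, HasDerivAt (gaussianPDFReal 0 1) (-x * gaussianPDFReal 0 1 x) x := by
    intro x
    have h : HasDerivAt (fun x : ℝ => -(x - 0) ^ 2 / (2 * ((1 : NNReal) : ℝ))) (-x) x := by
      have h := ((((hasDerivAt_id' x).sub_const 0).fun_pow 2).fun_neg).div_const
        (2 * ((1 : NNReal) : ℝ))
      refine h.congr_deriv ?_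
      simp only [NNReal.coe_one, Nat.cast_ofNat]
      ring
    rw [gaussianPDFReal_def]
    refine (h.exp.const_mul ((√(2 * Real.pi * ((1 : NNReal) : ℝ)))⁻¹)).congr_deriv ?_
    ring
  have key := integral_mul_deriv_eq_deriv_mul_of_integrable
    (u := fun x => p.eval x) (u' := fun x => p.derivative.eval x)
    (v := gaussianPDFReal 0 1) (v' := fun x => -x * gaussianPDFReal 0 1 x)
    (fun x _ => p.hasDerivAt x) (fun x _ => hd x)
    (by
      refine ((hI (-(Polynomial.X * p))).congr (ae_of_all _ fun x => ?_))
      simp; ring)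
    (hI _) (hI _)
  rw [integral_gaussianReal_eq_integral_smul one_ne_zero,
    integral_gaussianReal_eq_integral_smul one_ne_zero]
  simp only [smul_eq_mul]
  have h1 : ∀ x : ℝ, gaussianPDFReal 0 1 x * (x * p.eval x) =
      -(p.eval x * (-x * gaussianPDFReal 0 1 x)) := fun x => by ring
  simp_rw [h1]
  rw [integral_neg, key, neg_neg]
  simp_rw [mul_comm]

/-- By Stein's identity the raising operator X - d/dx is adjoint to d/dx, so an index can be removed
from the first factor at the cost of differentiating the second. -/
theorem integral_realHermite_mul (m n : ℕ) :
    ∫ x, (realHermite m).eval x * (realHermite n).eval x ∂gaussianReal 0 1 =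
      if m = n then (n.factorial : ℝ) else 0 := by
  have step : ∀ (m : ℕ) (p : Polynomial ℝ),
      ∫ x, (realHermite (m + 1)).eval x * p.eval x ∂gaussianReal 0 1 =
        ∫ x, (realHermite m).eval x * p.derivative.eval x ∂gaussianReal 0 1 := by
    intro m p
    have h1 : ∀ x : ℝ, (realHermite (m + 1)).eval x * p.eval x =
        x * (realHermite m * p).eval x -
          ((realHermite m).derivative * p).eval x := by
      intro x; simp [realHermite_succ]; ring
    simp_rw [h1]
    rw [integral_sub _ (integrable_eval_gaussianReal _), integral_X_mul_gaussianReal,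
      ← integral_sub (integrable_eval_gaussianReal _) (integrable_eval_gaussianReal _)]
    · congr 1; ext x; simp
    · exact (integrable_eval_gaussianReal (Polynomial.X * (realHermite m * p))).congr
        (ae_of_all _ fun x => by simp)
  induction m generalizing n with
  | zero =>
    cases n with
    | zero => simp [realHermite_zero]
    | succ n =>
      simp_rw [mul_comm (Polynomial.eval _ (realHermite 0))]
      rw [step]
      simp [realHermite_zero]
  | succ m ih =>
    rw [step]
    cases n with
    | zero => simp [realHermite_zero]
    | succ n =>
      rw [derivative_realHermite_succ]
      have h1 : ∀ x : ℝ, (realHermite m).eval x *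
          (Polynomial.C ((n : ℝ) + 1) * realHermite n).eval x =
          ((n : ℝ) + 1) * ((realHermite m).eval x * (realHermite n).eval x) := by
        intro x; simp; ring
      simp_rw [h1]
      rw [integral_const_mul, ih]
      simp [Nat.factorial_succ]

/-- Monomials are combinations of Hermite polynomials of at most the same degree. -/
theorem exists_pow_eq_sum_realHermite (n : ℕ) :
    ∃ c : ℕ → ℝ, ∀ y : ℝ,
      y ^ n = ∑ j ∈ Finset.range (n + 1), c j * (realHermite j).eval y := by
  -- The average of He_n(z + y) over Gaussian z is computed twice: expanding around y gives these
  -- coefficients, expanding around z leaves only y ^ n.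
  refine ⟨fun j => (n.choose j : ℝ) * ∫ z, z ^ (n - j) ∂gaussianReal 0 1, fun y => ?_⟩
  have hpow : ∀ m : ℕ, Integrable (fun z : ℝ => z ^ m) (gaussianReal 0 1) := fun m =>
    (integrable_eval_gaussianReal (Polynomial.X ^ m)).congr (ae_of_all _ fun x => by simp)
  have h1 : ∫ z, (realHermite n).eval (z + y) ∂gaussianReal 0 1 =
      ∑ j ∈ Finset.range (n + 1),
        (n.choose j : ℝ) * (∫ z, z ^ (n - j) ∂gaussianReal 0 1) * (realHermite j).eval y := by
    simp_rw [eval_realHermite_add]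
    rw [integral_finsetSum _ fun j _ => ((hpow _).const_mul _).mul_const _]
    simp_rw [integral_mul_const, integral_const_mul]
  have h2 : ∫ z, (realHermite n).eval (z + y) ∂gaussianReal 0 1 = y ^ n := by
    simp_rw [fun z : ℝ => add_comm z y, eval_realHermite_add]
    rw [integral_finsetSum _ fun j _ => (integrable_eval_gaussianReal _).const_mul _]
    simp_rw [integral_const_mul]
    have h3 : ∀ j, ∫ z, (realHermite j).eval z ∂gaussianReal 0 1 = if j = 0 then 1 else 0 := by
      intro j
      simpa [realHermite_zero] using integral_realHermite_mul j 0
    simp [h3]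
  rw [← h2, h1]

/-! ### Multi-indices and Hermite polynomials in several variables. -/

/-- The multi-indices dominated by `α`. -/
def multiBox {ι : Type*} [Fintype ι] [DecidableEq ι] (α : ι → ℕ) : Finset (ι → ℕ) :=
  Fintype.piFinset fun e => Finset.range (α e + 1)

@[simp]
theorem mem_multiBox {ι : Type*} [Fintype ι] [DecidableEq ι] {α β : ι → ℕ} : β ∈ multiBox α ↔ β ≤ α := by
  simp [multiBox, Pi.le_def]

/-- The multi-indices of degree at most `D`. -/
def multiIndices (ι : Type*) [Fintype ι] [DecidableEq ι] (D : ℕ) : Finset (ι → ℕ) :=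
  {α ∈ multiBox (fun _ : ι => D) | ∑ e, α e ≤ D}

@[simp]
theorem mem_multiIndices {ι : Type*} [Fintype ι] [DecidableEq ι] {D : ℕ} {α : ι → ℕ} : α ∈ multiIndices ι D ↔ ∑ e, α e ≤ D := by
  simp only [multiIndices, Finset.mem_filter, mem_multiBox, and_iff_right_iff_imp]
  exact fun h e => (Finset.single_le_sum (fun _ _ => Nat.zero_le _) (Finset.mem_univ e)).trans h

/-- The product of the binomial coefficients of the entries of two multi-indices. -/
def multiChoose {ι : Type*} [Fintype ι] (α β : ι → ℕ) : ℕ := ∏ e, (α e).choose (β e)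

/-- Hermite polynomials in several variables. -/
noncomputable def multiHermite {ι : Type*} [Fintype ι] (α : ι → ℕ) (z : ι → ℝ) : ℝ :=
  ∏ e, (realHermite (α e)).eval (z e)

theorem multiHermite_zero {ι : Type*} [Fintype ι] (z : ι → ℝ) : multiHermite 0 z = 1 := by
  simp [multiHermite, realHermite_zero]

theorem multiHermite_add {ι : Type*} [Fintype ι] [DecidableEq ι] (α : ι → ℕ) (x z : ι → ℝ) :
    multiHermite α (x + z) =
      ∑ β ∈ multiBox α, (multiChoose α β : ℝ) * (∏ e, x e ^ (α e - β e)) * multiHermite β z := by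
  simp only [multiHermite, Pi.add_apply, eval_realHermite_add, multiBox, multiChoose]
  rw [Finset.prod_univ_sum]
  refine Finset.sum_congr rfl fun β _ => ?_
  rw [Finset.prod_mul_distrib, Finset.prod_mul_distrib]
  push_cast
  rfl

theorem integrable_multiHermite_mul {ι : Type*} [Fintype ι] (α β : ι → ℕ) :
    Integrable (fun z => multiHermite α z * multiHermite β z)
      (Measure.pi fun _ : ι => gaussianReal 0 1) := by
  simp only [multiHermite, ← Finset.prod_mul_distrib]
  refine Integrable.fintype_prod (f := fun e z => (realHermite (α e)).eval z *
    (realHermite (β e)).eval z) fun e => ?_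
  exact (integrable_eval_gaussianReal (realHermite (α e) * realHermite (β e))).congr
    (ae_of_all _ fun x => by simp)

theorem integral_multiHermite_mul {ι : Type*} [Fintype ι] (α β : ι → ℕ) :
    ∫ z, multiHermite α z * multiHermite β z ∂(Measure.pi fun _ : ι => gaussianReal 0 1) =
      if α = β then ∏ e, ((β e).factorial : ℝ) else 0 := by
  simp only [multiHermite, ← Finset.prod_mul_distrib]
  rw [integral_fintype_prod_eq_prod (f := fun e z => (realHermite (α e)).eval z *
    (realHermite (β e)).eval z)]
  simp_rw [integral_realHermite_mul]
  split_ifs with h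
  · simp [h]
  · obtain ⟨e, he⟩ := Function.ne_iff.1 h
    exact Finset.prod_eq_zero (Finset.mem_univ e) (if_neg he)

/-- A polynomial of degree at most `D` is a combination of Hermite polynomials of degree at most
`D`. -/
theorem exists_eval_eq_sum_multiHermite {ι : Type*} [Fintype ι] [DecidableEq ι] {D : ℕ} (P : MvPolynomial ι ℝ) (hP : P.totalDegree ≤ D) :
    ∃ c : (ι → ℕ) → ℝ, ∀ y,
      MvPolynomial.eval y P = ∑ α ∈ multiIndices ι D, c α * multiHermite α y := by
  have hmon : ∀ s : ι →₀ ℕ, ∑ e, s e ≤ D → ∃ c : (ι → ℕ) → ℝ, ∀ y : ι → ℝ,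
      ∏ e, y e ^ s e = ∑ α ∈ multiIndices ι D, c α * multiHermite α y := by
    intro s hs
    choose c hc using exists_pow_eq_sum_realHermite
    refine ⟨fun β => if β ∈ multiBox (s : ι → ℕ) then ∏ e, c (s e) (β e) else 0, fun y => ?_⟩
    have hsub : multiBox (s : ι → ℕ) ⊆ multiIndices ι D := by
      intro β hβ
      rw [mem_multiBox] at hβ
      exact mem_multiIndices.2 ((Finset.sum_le_sum fun e _ => hβ e).trans hs)
    rw [← Finset.sum_subset hsub]
    · simp_rw [fun e => hc (s e) (y e)]
      rw [Finset.prod_univ_sum]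
      refine Finset.sum_congr rfl fun β hβ => ?_
      rw [if_pos hβ, Finset.prod_mul_distrib]
      rfl
    · intro β _ hβ
      simp [if_neg hβ]
  have hdeg : ∀ s ∈ P.support, ∑ e, s e ≤ D := by
    intro s hs
    have := (MvPolynomial.le_totalDegree hs).trans hP
    rwa [Finsupp.sum_fintype _ _ (fun _ => rfl)] at this
  choose! c hc using hmon
  refine ⟨fun α => ∑ s ∈ P.support, P.coeff s * c s α, fun y => ?_⟩
  rw [MvPolynomial.eval_eq']
  simp_rw [Finset.sum_mul]
  rw [Finset.sum_comm]
  refine Finset.sum_congr rfl fun s hs => ?_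
  rw [hc s (hdeg s hs) y, Finset.mul_sum]
  exact Finset.sum_congr rfl fun α _ => by ring

theorem integral_sum_multiHermite_sq {ι : Type*} [Fintype ι] (T : Finset (ι → ℕ))
    (b : (ι → ℕ) → ℝ) :
    ∫ z, (∑ β ∈ T, b β * multiHermite β z) ^ 2 ∂(Measure.pi fun _ : ι => gaussianReal 0 1) =
      ∑ β ∈ T, (∏ e, ((β e).factorial : ℝ)) * b β ^ 2 := by
  classical
  have h1 : ∀ z : ι → ℝ, (∑ β ∈ T, b β * multiHermite β z) ^ 2 =
      ∑ β ∈ T, ∑ γ ∈ T, b β * b γ * (multiHermite β z * multiHermite γ z) := by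
    intro z
    rw [sq, Finset.sum_mul_sum]
    exact Finset.sum_congr rfl fun β _ => Finset.sum_congr rfl fun γ _ => by ring
  simp_rw [h1]
  rw [integral_finsetSum _ fun β _ => integrable_finsetSum _ fun γ _ =>
    (integrable_multiHermite_mul β γ).const_mul _]
  refine Finset.sum_congr rfl fun β hβ => ?_
  rw [integral_finsetSum _ fun γ _ => (integrable_multiHermite_mul β γ).const_mul _]
  simp_rw [integral_const_mul, integral_multiHermite_mul]
  rw [Finset.sum_eq_single_of_mem β hβ fun γ _ hγ => by rw [if_neg (Ne.symm hγ), mul_zero]]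
  rw [if_pos rfl]
  ring

/-! ### The low-degree lower bound in terms of cumulants. -/

/-- The low-degree lower bound: the mean squared error of a polynomial of degree at most `D` in
`X + Z`, with `Z` standard Gaussian, is bounded below in terms of the joint cumulants `κ`. -/
theorem le_expect_integral_sq_of_cumulants {ι Ω : Type*} [Fintype ι] [DecidableEq ι] [Fintype Ω]
    [Nonempty Ω] (X : Ω → ι → ℝ) (x : Ω → ℝ) (κ : (ι → ℕ) → ℝ)
    (hκ : ∀ α, ∑ β ∈ multiBox α,
      (multiChoose α β : ℝ) * κ β * 𝔼 ω, ∏ e, X ω e ^ (α e - β e) =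
        𝔼 ω, x ω * ∏ e, X ω e ^ α e)
    {D : ℕ} (P : MvPolynomial ι ℝ) (hP : P.totalDegree ≤ D) :
    𝔼 ω, x ω ^ 2 - ∑ α ∈ multiIndices ι D, κ α ^ 2 ≤
      𝔼 ω, ∫ z, (MvPolynomial.eval (X ω + z) P - x ω) ^ 2
        ∂(Measure.pi fun _ : ι => gaussianReal 0 1) := by
  obtain ⟨c, hc⟩ := exists_eval_eq_sum_multiHermite P hP
  set T := multiIndices ι D with hT
  have h0T : (0 : ι → ℕ) ∈ T := by simp [hT]
  have hsub : ∀ α ∈ T, multiBox α ⊆ T := by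
    intro α hα β hβ
    rw [mem_multiBox] at hβ
    exact mem_multiIndices.2 ((Finset.sum_le_sum fun e _ => hβ e).trans (mem_multiIndices.1 hα))
  -- `a ω β` is the coefficient of the β-th Hermite polynomial in z ↦ P(X ω + z), read off from
  -- `multiHermite_add`.
  set a : Ω → (ι → ℕ) → ℝ := fun ω β => ∑ α ∈ T,
    if β ∈ multiBox α then c α * multiChoose α β * ∏ e, X ω e ^ (α e - β e) else 0 with ha
  have hswap : ∀ F : (ι → ℕ) → (ι → ℕ) → ℝ, ∑ α ∈ T, ∑ β ∈ multiBox α, F α β =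
      ∑ β ∈ T, ∑ α ∈ T, if β ∈ multiBox α then F α β else 0 := by
    intro F
    rw [Finset.sum_comm]
    refine Finset.sum_congr rfl fun α hα => ?_
    rw [← Finset.sum_filter, Finset.filter_mem_eq_inter, Finset.inter_eq_right.2 (hsub α hα)]
  have hexp : ∀ ω z, MvPolynomial.eval (X ω + z) P = ∑ β ∈ T, a ω β * multiHermite β z := by
    intro ω z
    simp_rw [hc, multiHermite_add, Finset.mul_sum]
    rw [hswap]
    refine Finset.sum_congr rfl fun β _ => ?_
    rw [ha, Finset.sum_mul]
    refine Finset.sum_congr rfl fun α _ => ?_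
    split_ifs <;> ring
  have hint : ∀ ω, ∫ z, (MvPolynomial.eval (X ω + z) P - x ω) ^ 2
      ∂(Measure.pi fun _ : ι => gaussianReal 0 1) =
      ∑ β ∈ T, (∏ e, ((β e).factorial : ℝ)) * a ω β ^ 2 - 2 * (x ω * a ω 0) + x ω ^ 2 := by
    intro ω
    have h1 : ∀ z, MvPolynomial.eval (X ω + z) P - x ω =
        ∑ β ∈ T, (a ω β - if β = 0 then x ω else 0) * multiHermite β z := by
      intro z
      simp_rw [hexp, sub_mul]
      rw [Finset.sum_sub_distrib]
      congr 1
      simp [h0T, multiHermite_zero]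
    simp_rw [h1]
    rw [integral_sum_multiHermite_sq]
    have h2 : ∀ β : ι → ℕ, (∏ e, ((β e).factorial : ℝ)) * (a ω β - if β = 0 then x ω else 0) ^ 2 =
        (∏ e, ((β e).factorial : ℝ)) * a ω β ^ 2 +
          if β = 0 then x ω ^ 2 - 2 * (x ω * a ω 0) else 0 := by
      intro β
      split_ifs with h
      · subst h
        simp only [Pi.zero_apply, Nat.factorial_zero, Nat.cast_one, Finset.prod_const_one]
        ring
      · ring
    simp_rw [h2]
    rw [Finset.sum_add_distrib, Finset.sum_ite_eq' T, if_pos h0T]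
    ring
  -- Since `a ω 0` is ∑ c α X^α, the system `hκ` weighted by `c α` expresses the correlation with x
  -- through the means of all the Hermite coefficients.
  have hcross : 𝔼 ω, x ω * a ω 0 = ∑ β ∈ T, κ β * 𝔼 ω, a ω β := by
    have h1 : 𝔼 ω, x ω * a ω 0 = ∑ α ∈ T, c α * 𝔼 ω, x ω * ∏ e, X ω e ^ α e := by
      simp_rw [Finset.mul_expect]
      rw [← Finset.expect_sum_comm]
      refine Finset.expect_congr rfl fun ω _ => ?_
      rw [ha, Finset.mul_sum]
      refine Finset.sum_congr rfl fun α _ => ?_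
      have : (0 : ι → ℕ) ∈ multiBox α := mem_multiBox.2 (fun e => Nat.zero_le _)
      simp only [this, if_true, multiChoose, Pi.zero_apply, Nat.choose_zero_right,
        Finset.prod_const_one, Nat.cast_one, Nat.sub_zero]
      ring
    rw [h1]
    simp_rw [← hκ, Finset.mul_sum]
    rw [hswap]
    refine Finset.sum_congr rfl fun β _ => ?_
    rw [ha, Finset.expect_sum_comm, Finset.mul_sum]
    refine Finset.sum_congr rfl fun α _ => ?_
    split_ifs
    · rw [← Finset.mul_expect]; ring
    · simp
  have hjensen : ∀ β, (𝔼 ω, a ω β) ^ 2 ≤ 𝔼 ω, a ω β ^ 2 := by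
    intro β
    have h1 : 0 ≤ 𝔼 ω, (a ω β - 𝔼 ω', a ω' β) ^ 2 := Finset.expect_nonneg fun ω _ => sq_nonneg _
    simp_rw [sub_sq] at h1
    rw [Finset.expect_add_distrib, Finset.expect_sub_distrib, ← Finset.expect_mul,
      ← Finset.mul_expect, Fintype.expect_const] at h1
    nlinarith
  simp_rw [hint]
  rw [Finset.expect_add_distrib, Finset.expect_sub_distrib, ← Finset.mul_expect, hcross,
    Finset.expect_sum_comm]
  simp_rw [← Finset.mul_expect]
  -- With u = 𝔼 a_β: 2κu - κ² ≤ u² ≤ 𝔼 a_β², and the factorial weight is at least 1.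
  have hterm : ∀ β ∈ T, 2 * (κ β * 𝔼 ω, a ω β) - κ β ^ 2 ≤
      (∏ e, ((β e).factorial : ℝ)) * 𝔼 ω, a ω β ^ 2 := by
    intro β _
    have h1 : (1 : ℝ) ≤ ∏ e, ((β e).factorial : ℝ) :=
      Finset.one_le_prod fun e _ => by exact_mod_cast Nat.succ_le_of_lt (Nat.factorial_pos _)
    have h2 := hjensen β
    have h3 : 0 ≤ 𝔼 ω, a ω β ^ 2 := (sq_nonneg _).trans h2
    nlinarith [sq_nonneg (κ β - 𝔼 ω, a ω β)]
  have := Finset.sum_le_sum hterm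
  rw [Finset.sum_sub_distrib, ← Finset.mul_sum] at this
  linarith

/-! ### Joint cumulants: recursion, independence, scaling. -/

theorem sum_lt_sum_of_mem_erase_multiBox {ι : Type*} [Fintype ι] [DecidableEq ι] {α β : ι → ℕ}
    (h : β ∈ (multiBox α).erase α) : ∑ e, β e < ∑ e, α e := by
  obtain ⟨h1, h2⟩ := Finset.mem_erase.1 h
  rw [mem_multiBox] at h2
  obtain ⟨e, he⟩ := Function.ne_iff.1 h1
  exact Finset.sum_lt_sum (fun e _ => h2 e) ⟨e, Finset.mem_univ e, lt_of_le_of_ne (h2 e) he⟩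

/-- The joint cumulants of `x` and of the coordinates of `X` repeated according to a multi-index,
as a function of the moments `m α = 𝔼 X ^ α` and of the mixed moments `c α = 𝔼 x X ^ α`. -/
noncomputable def cumulant {ι : Type*} [Fintype ι] [DecidableEq ι] (c m : (ι → ℕ) → ℝ)
    (α : ι → ℕ) : ℝ :=
  c α - ∑ β ∈ ((multiBox α).erase α).attach,
    (multiChoose α β.1 : ℝ) * cumulant c m β.1 * m (α - β.1)
termination_by ∑ e, α e
decreasing_by exact sum_lt_sum_of_mem_erase_multiBox β.2

theorem cumulant_eq {ι : Type*} [Fintype ι] [DecidableEq ι] (c m : (ι → ℕ) → ℝ) (α : ι → ℕ) :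
    cumulant c m α = c α - ∑ β ∈ (multiBox α).erase α,
      (multiChoose α β : ℝ) * cumulant c m β * m (α - β) := by
  rw [cumulant, Finset.sum_attach ((multiBox α).erase α)
    (fun β => (multiChoose α β : ℝ) * cumulant c m β * m (α - β))]

/-- The defining recursion solved for `c α`. This is the linear system that
`le_expect_integral_sq_of_cumulants` asks of `κ`. -/
theorem sum_multiBox_cumulant {ι : Type*} [Fintype ι] [DecidableEq ι] (c m : (ι → ℕ) → ℝ)
    (hm : m 0 = 1) (α : ι → ℕ) :
    ∑ β ∈ multiBox α, (multiChoose α β : ℝ) * cumulant c m β * m (α - β) = c α := by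
  rw [← Finset.sum_erase_add _ _ (mem_multiBox.2 (le_refl α)), cumulant_eq c m α]
  simp [multiChoose, hm]

/-- The part of a multi-index carried by the indices satisfying `p`. -/
def restrictIndex {ι : Type*} (p : ι → Prop) [DecidablePred p] (α : ι → ℕ) : ι → ℕ :=
  fun e => if p e then α e else 0

/-- A joint cumulant vanishes when the variables split into two independent groups. -/
theorem cumulant_eq_zero_of_split {ι : Type*} [Fintype ι] [DecidableEq ι] (c m : (ι → ℕ) → ℝ)
    (hm0 : m 0 = 1) (p : ι → Prop) [DecidablePred p] (α : ι → ℕ)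
    (hc : ∀ β ≤ α, c β = c (restrictIndex p β) * m (restrictIndex (fun e => ¬ p e) β))
    (hm : ∀ β ≤ α, m β = m (restrictIndex p β) * m (restrictIndex (fun e => ¬ p e) β))
    (hα : restrictIndex (fun e => ¬ p e) α ≠ 0) : cumulant c m α = 0 := by
  have hle : restrictIndex p α ≤ α := fun e => by
    unfold restrictIndex; split_ifs <;> simp
  have hsub : multiBox (restrictIndex p α) ⊆ (multiBox α).erase α := by
    intro β hβ
    rw [mem_multiBox] at hβ
    refine Finset.mem_erase.2 ⟨?_, mem_multiBox.2 (hβ.trans hle)⟩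
    rintro rfl
    apply hα
    funext e
    have := hβ e
    simp only [restrictIndex, Pi.zero_apply] at this ⊢
    split_ifs at this ⊢ with h <;> simp_all
  -- By induction only the β carried by `p` survive in the recursion. For these the factor m of the
  -- complementary part comes out, and the rest resums to `c (restrictIndex p α)`; the total is `c
  -- α` and cancels it.
  rw [cumulant_eq, ← Finset.sum_subset hsub]
  · rw [hc α le_rfl, ← sum_multiBox_cumulant c m hm0 (restrictIndex p α), Finset.sum_mul,
      ← Finset.sum_sub_distrib]
    refine Finset.sum_eq_zero fun β hβ => ?_
    rw [mem_multiBox] at hβ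
    have h0 : ∀ e, ¬ p e → β e = 0 := fun e he => by
      have := hβ e
      simpa [restrictIndex, he] using this
    rw [hm (α - β) (fun e => Nat.sub_le _ _)]
    have h1 : restrictIndex p (α - β) = restrictIndex p α - β := by
      funext e
      by_cases he : p e <;> simp [restrictIndex, he]
    have h2 : restrictIndex (fun e => ¬ p e) (α - β) = restrictIndex (fun e => ¬ p e) α := by
      funext e
      by_cases he : p e <;> simp [restrictIndex, he, h0]
    have h3 : multiChoose (restrictIndex p α) β = multiChoose α β := by
      refine Finset.prod_congr rfl fun e _ => ?_
      by_cases he : p e <;> simp [restrictIndex, he, h0]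
    rw [h1, h2, h3]
    ring
  · intro β hβ hβ'
    have hlt := sum_lt_sum_of_mem_erase_multiBox hβ
    have hβα : β ≤ α := mem_multiBox.1 (Finset.mem_of_mem_erase hβ)
    have : restrictIndex (fun e => ¬ p e) β ≠ 0 := by
      intro h0
      apply hβ'
      rw [mem_multiBox]
      intro e
      have := congrFun h0 e
      have := hβα e
      by_cases he : p e <;> simp_all [restrictIndex]
    rw [cumulant_eq_zero_of_split c m hm0 p β (fun γ hγ => hc γ (hγ.trans hβα))
      (fun γ hγ => hm γ (hγ.trans hβα)) this]
    simp
termination_by ∑ e, α e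

/-- Scaling `x` and `X` by `t` scales the cumulants. -/
theorem cumulant_scale {ι : Type*} [Fintype ι] [DecidableEq ι] (c m : (ι → ℕ) → ℝ) (t : ℝ)
    (α : ι → ℕ) :
    cumulant (fun α => t ^ (∑ e, α e + 1) * c α) (fun α => t ^ (∑ e, α e) * m α) α =
      t ^ (∑ e, α e + 1) * cumulant c m α := by
  rw [cumulant_eq, cumulant_eq c m, mul_sub, Finset.mul_sum]
  congr 1
  refine Finset.sum_congr rfl fun β hβ => ?_
  have hlt := sum_lt_sum_of_mem_erase_multiBox hβ
  have hβα : β ≤ α := mem_multiBox.1 (Finset.mem_of_mem_erase hβ)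
  rw [cumulant_scale c m t β]
  have h1 : ∑ e, α e + 1 = (∑ e, β e + 1) + ∑ e, (α - β) e := by
    have : ∑ e, α e = ∑ e, β e + ∑ e, (α - β) e := by
      rw [← Finset.sum_add_distrib]
      exact Finset.sum_congr rfl fun e _ => (Nat.add_sub_cancel' (hβα e)).symm
    lia
  rw [h1, pow_add]
  ring
termination_by ∑ e, α e

/-- A product of binomial theorems, one per index; it closes the induction in `abs_cumulant_le`. -/
theorem sum_multiBox_multiChoose_mul_pow {ι : Type*} [Fintype ι] [DecidableEq ι] (α : ι → ℕ)
    (t : ℝ) : ∑ β ∈ multiBox α, (multiChoose α β : ℝ) * t ^ (∑ e, β e) = (t + 1) ^ (∑ e, α e) := by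
  rw [← Finset.prod_pow_eq_pow_sum]
  simp_rw [add_pow]
  rw [Finset.prod_univ_sum]
  refine Finset.sum_congr rfl fun β _ => ?_
  simp only [multiChoose, one_pow, mul_one]
  rw [Finset.prod_mul_distrib, Finset.prod_pow_eq_pow_sum, mul_comm]
  push_cast
  rfl

/-! ### Averages over uniform labelings. -/

/-- A set of labelings in which the labels outside `R` determine the others has small
probability. -/
theorem expect_indicator_le {V K : Type*} [Fintype V] [DecidableEq V] [Fintype K] [Nonempty K]
    (A : (V → K) → Prop) [DecidablePred A] (R : Finset V)
    (h : ∀ z z', A z → A z' → (∀ v, v ∉ R → z v = z' v) → z = z') :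
    (𝔼 z : V → K, if A z then (1 : ℝ) else 0) ≤ ((Fintype.card K : ℝ)⁻¹) ^ R.card := by
  classical
  have hcard : Fintype.card {z // A z} ≤ Fintype.card ({v // v ∉ R} → K) :=
    Fintype.card_le_of_injective (fun z v => z.1 v.1) fun z z' hz =>
      Subtype.ext (h _ _ z.2 z'.2 fun v hv => congrFun hz ⟨v, hv⟩)
  have hR : Fintype.card {v // v ∉ R} + R.card = Fintype.card V := by
    rw [Fintype.card_subtype_compl, Fintype.card_coe]
    exact Nat.sub_add_cancel (Finset.card_le_univ R)
  have hK : (0 : ℝ) < Fintype.card K := by exact_mod_cast Fintype.card_pos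
  rw [Fintype.expect_eq_sum_div_card, Finset.sum_boole, ← Fintype.card_subtype, inv_pow,
    div_le_iff₀ (by exact_mod_cast Fintype.card_pos), Fintype.card_fun, ← hR]
  push_cast
  rw [pow_add, mul_comm, mul_assoc, mul_inv_cancel₀ (by positivity), mul_one]
  calc (Fintype.card {z // A z} : ℝ) ≤ (Fintype.card ({v // v ∉ R} → K) : ℕ) := by
        exact_mod_cast hcard
    _ = _ := by rw [Fintype.card_fun]; push_cast; rfl

/-- Functions of disjoint sets of labels are independent. -/
theorem expect_mul_of_disjoint {V K : Type*} [Fintype V] [DecidableEq V] [Fintype K] [Nonempty K]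
    (S : Finset V) (F G : (V → K) → ℝ) (hF : ∀ z z', (∀ v ∈ S, z v = z' v) → F z = F z')
    (hG : ∀ z z', (∀ v, v ∉ S → z v = z' v) → G z = G z') :
    𝔼 z, F z * G z = (𝔼 z, F z) * 𝔼 z, G z := by
  -- Exchanging the labels outside `S` between two independent copies preserves the uniform law and
  -- carries F(z₁)G(z₁) to F(z₁)G(z₂).
  let sw : (V → K) × (V → K) → (V → K) × (V → K) :=
    fun z => (S.piecewise z.1 z.2, S.piecewise z.2 z.1)
  have hsw : Function.Involutive sw := by
    intro z
    ext v <;> by_cases hv : v ∈ S <;> simp [sw, hv]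
  have h1 : (𝔼 z, F z) * 𝔼 z, G z = 𝔼 z : (V → K) × (V → K), F z.1 * G z.2 := by
    rw [Finset.expect_mul_expect, ← Finset.univ_product_univ, Finset.expect_product]
  have h2 : 𝔼 z, F z * G z = 𝔼 z : (V → K) × (V → K), F z.1 * G z.1 := by
    rw [← Finset.univ_product_univ, Finset.expect_product]
    simp
  rw [h1, h2]
  refine Fintype.expect_equiv hsw.toPerm _ _ fun z => ?_
  have e1 : F z.1 = F (sw z).1 := hF _ _ fun v hv => by simp [sw, hv]
  have e2 : G z.1 = G (sw z).2 := hG _ _ fun v hv => by simp [sw, hv]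
  simp [e1, e2]

/-- The event `z i = z j` is independent of every function invariant under shifts of the labels in
a set that separates `i` from `j`. -/
theorem expect_eq_mul_of_shift {V K : Type*} [Fintype V] [DecidableEq V] [Fintype K]
    [DecidableEq K] [AddCommGroup K] (S : Finset V) {i j : V} (hi : i ∈ S) (hj : j ∉ S)
    (G : (V → K) → ℝ) (hG : ∀ z c, G (fun v => if v ∈ S then z v + c else z v) = G z) :
    (𝔼 z : V → K, (if z i = z j then (1 : ℝ) else 0) * G z) =
      (Fintype.card K : ℝ)⁻¹ * 𝔼 z, G z := by
  let sh : K → Equiv.Perm (V → K) := fun c =>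
    { toFun := fun z v => if v ∈ S then z v + c else z v
      invFun := fun z v => if v ∈ S then z v - c else z v
      left_inv := fun z => by ext v; by_cases hv : v ∈ S <;> simp [hv]
      right_inv := fun z => by ext v; by_cases hv : v ∈ S <;> simp [hv] }
  have h1 : ∀ c : K, (𝔼 z : V → K, (if z i = z j then (1 : ℝ) else 0) * G z) =
      𝔼 z : V → K, (if z i + c = z j then (1 : ℝ) else 0) * G z := by
    intro c
    refine (Fintype.expect_equiv (sh c) _ _ fun z => ?_).symm
    simp [sh, hi, hj, hG]
  -- Averaging over all shifts c decouples the event from `G`: for each z exactly one c satisfies z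
  -- i + c = z j.
  have h2 : (𝔼 z : V → K, (if z i = z j then (1 : ℝ) else 0) * G z) =
      𝔼 c : K, 𝔼 z : V → K, (if z i + c = z j then (1 : ℝ) else 0) * G z := by
    simp_rw [← h1]
    simp
  rw [h2, Finset.expect_comm]
  simp_rw [← Finset.expect_mul]
  have h3 : ∀ z : V → K, (𝔼 c : K, if z i + c = z j then (1 : ℝ) else 0) =
      (Fintype.card K : ℝ)⁻¹ := by
    intro z
    simp_rw [← eq_sub_iff_add_eq']
    rw [Fintype.expect_eq_sum_div_card]
    simp
  simp_rw [h3, ← Finset.mul_expect]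

/-! ### Moments and cumulants of monochromatic edges. -/

/-- The product of the indicators that the edges of a multigraph (with edge multiplicities `α`,
edge `e` joining `a e` to `b e`) are monochromatic. -/
noncomputable def edgeProd {V K ι : Type*} [Fintype ι] [DecidableEq K] (a b : ι → V) (α : ι → ℕ)
    (z : V → K) : ℝ :=
  ∏ e, (if z (a e) = z (b e) then (1 : ℝ) else 0) ^ α e

/-- The probability that all edges of a multigraph are monochromatic. -/
noncomputable def edgeMoment {V : Type*} (K : Type*) {ι : Type*} [Fintype V] [DecidableEq V]
    [Fintype K] [DecidableEq K] [Fintype ι] (a b : ι → V) (α : ι → ℕ) : ℝ :=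
  𝔼 z : V → K, edgeProd a b α z

/-- The probability that all edges of a multigraph, and the edge `i j`, are monochromatic. -/
noncomputable def markedEdgeMoment {V : Type*} (K : Type*) {ι : Type*} [Fintype V] [DecidableEq V]
    [Fintype K] [DecidableEq K] [Fintype ι] (a b : ι → V) (i j : V) (α : ι → ℕ) : ℝ :=
  𝔼 z : V → K, (if z i = z j then (1 : ℝ) else 0) * edgeProd a b α z

/-- The endpoints of a multigraph, together with `j` and without `i`. -/
def reducedSupport {V ι : Type*} [DecidableEq V] [Fintype ι] (a b : ι → V) (i j : V)
    (α : ι → ℕ) : Finset V :=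
  (insert j ({e | α e ≠ 0}.toFinset.image a ∪ {e | α e ≠ 0}.toFinset.image b)).erase i

theorem mem_reducedSupport {V ι : Type*} [DecidableEq V] [Fintype ι] {a b : ι → V} {i j : V}
    {α : ι → ℕ} {v : V} :
    v ∈ reducedSupport a b i j α ↔
      v ≠ i ∧ (v = j ∨ (∃ e, α e ≠ 0 ∧ a e = v) ∨ ∃ e, α e ≠ 0 ∧ b e = v) := by
  simp [reducedSupport]

theorem edgeProd_eq_ite {V K ι : Type*} [Fintype ι] [DecidableEq K] (a b : ι → V) (α : ι → ℕ)
    (z : V → K) [Decidable (∀ e, α e ≠ 0 → z (a e) = z (b e))] :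
    edgeProd a b α z = if ∀ e, α e ≠ 0 → z (a e) = z (b e) then 1 else 0 := by
  unfold edgeProd
  split_ifs with h
  · refine Finset.prod_eq_one fun e _ => ?_
    by_cases he : α e = 0
    · simp [he]
    · simp [h e he]
  · push Not at h
    obtain ⟨e, he, hz⟩ := h
    exact Finset.prod_eq_zero (Finset.mem_univ e) (by simp [hz, he])

theorem edgeProd_restrict_mul {V K ι : Type*} [Fintype ι] [DecidableEq K] (a b : ι → V)
    (α : ι → ℕ) (p : ι → Prop) [DecidablePred p] (z : V → K) :
    edgeProd a b α z = edgeProd a b (restrictIndex p α) z *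
      edgeProd a b (restrictIndex (fun e => ¬ p e) α) z := by
  unfold edgeProd
  rw [← Finset.prod_mul_distrib]
  refine Finset.prod_congr rfl fun e _ => ?_
  by_cases he : p e <;> simp [restrictIndex, he]

theorem edgeProd_congr {V K ι : Type*} [Fintype ι] [DecidableEq K] (a b : ι → V)
    (α : ι → ℕ) {z z' : V → K}
    (h : ∀ e, α e ≠ 0 → (z (a e) = z (b e) ↔ z' (a e) = z' (b e))) :
    edgeProd a b α z = edgeProd a b α z' := by
  refine Finset.prod_congr rfl fun e _ => ?_
  by_cases he : α e = 0
  · simp [he]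
  · simp [h e he]

theorem edgeMoment_zero {V K ι : Type*} [Fintype V] [DecidableEq V] [Fintype K] [DecidableEq K]
    [Nonempty K] [Fintype ι] (a b : ι → V) : edgeMoment K a b 0 = 1 := by
  simp [edgeMoment, edgeProd]

/-- A nonzero cumulant comes from a multigraph which is connected and covers `i` and `j`. -/
theorem mem_of_cumulant_ne_zero {V K ι : Type*} [Fintype V] [DecidableEq V] [Fintype K]
    [DecidableEq K] [AddCommGroup K] [Fintype ι] [DecidableEq ι] (a b : ι → V) (i j : V)
    {α : ι → ℕ} (hα : α ≠ 0)
    (hκ : cumulant (markedEdgeMoment K a b i j) (edgeMoment K a b) α ≠ 0) (S : Finset V)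
    (hi : i ∈ S) (hS : ∀ e, α e ≠ 0 → (a e ∈ S ↔ b e ∈ S)) :
    j ∈ S ∧ ∀ e, α e ≠ 0 → a e ∈ S ∧ b e ∈ S := by
  have hle : ∀ {β : ι → ℕ}, β ≤ α → ∀ e, β e ≠ 0 → (a e ∈ S ↔ b e ∈ S) := fun hβ e he =>
    hS e fun h0 => he (Nat.le_zero.1 (h0 ▸ hβ e))
  -- If `S` separated i from j, shifting the labels on `S` would preserve every edge event, so the
  -- marked event would be independent of all the edges. This is a split with nothing on the side of
  -- the marked variable, hence `p` is constantly `False`.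
  have hj : j ∈ S := by
    by_contra hj
    apply hκ
    have hshift : ∀ β ≤ α, markedEdgeMoment K a b i j β =
        (Fintype.card K : ℝ)⁻¹ * edgeMoment K a b β := by
      intro β hβ
      refine expect_eq_mul_of_shift S hi hj _ fun z c => edgeProd_congr a b β fun e he => ?_
      have := hle hβ e he
      by_cases h : a e ∈ S
      · simp [h, this.1 h]
      · simp [h, mt this.2 h]
    refine cumulant_eq_zero_of_split _ _ (edgeMoment_zero a b) (fun _ => False) α ?_ ?_ ?_
    · intro β hβ
      have h0 : restrictIndex (fun _ : ι => False) β = 0 := by funext e; simp [restrictIndex]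
      have h1 : restrictIndex (fun _ : ι => ¬ False) β = β := by funext e; simp [restrictIndex]
      rw [h0, h1, hshift β hβ, hshift 0 (fun e => Nat.zero_le _), edgeMoment_zero, mul_one]
    · intro β hβ
      have h0 : restrictIndex (fun _ : ι => False) β = 0 := by funext e; simp [restrictIndex]
      have h1 : restrictIndex (fun _ : ι => ¬ False) β = β := by funext e; simp [restrictIndex]
      rw [h0, h1, edgeMoment_zero, one_mul]
    · have h1 : restrictIndex (fun _ : ι => ¬ False) α = α := by funext e; simp [restrictIndex]
      rwa [h1]
  refine ⟨hj, ?_⟩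
  by_contra hne
  push Not at hne
  obtain ⟨e₀, he₀, hne⟩ := hne
  have ha₀ : a e₀ ∉ S := fun h => hne h ((hS e₀ he₀).1 h)
  apply hκ
  -- An edge outside `S` splits the multigraph: the edges inside `S`, with the marked pair, and the
  -- edges outside depend on disjoint sets of labels.
  have hin : ∀ β ≤ α, ∀ z z' : V → K, (∀ v ∈ S, z v = z' v) →
      edgeProd a b (restrictIndex (fun e => a e ∈ S) β) z =
        edgeProd a b (restrictIndex (fun e => a e ∈ S) β) z' := by
    intro β hβ z z' hz
    refine edgeProd_congr a b _ fun e he => ?_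
    by_cases h : a e ∈ S
    · rw [hz _ h, hz _ ((hle hβ e (by simpa [restrictIndex, h] using he)).1 h)]
    · simp [restrictIndex, h] at he
  have hout : ∀ β ≤ α, ∀ z z' : V → K, (∀ v, v ∉ S → z v = z' v) →
      edgeProd a b (restrictIndex (fun e => ¬ a e ∈ S) β) z =
        edgeProd a b (restrictIndex (fun e => ¬ a e ∈ S) β) z' := by
    intro β hβ z z' hz
    refine edgeProd_congr a b _ fun e he => ?_
    by_cases h : a e ∈ S
    · simp [restrictIndex, h] at he
    · rw [hz _ h, hz _ (mt (hle hβ e (by simpa [restrictIndex, h] using he)).2 h)]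
  refine cumulant_eq_zero_of_split _ _ (edgeMoment_zero a b) (fun e => a e ∈ S) α ?_ ?_ ?_
  · intro β hβ
    unfold markedEdgeMoment edgeMoment
    rw [← expect_mul_of_disjoint S _ _ _ (hout β hβ)]
    · refine Finset.expect_congr rfl fun z _ => ?_
      rw [edgeProd_restrict_mul a b β (fun e => a e ∈ S) z, mul_assoc]
    · intro z z' hz
      rw [hin β hβ z z' hz, hz i hi, hz j hj]
  · intro β hβ
    unfold edgeMoment
    rw [← expect_mul_of_disjoint S _ _ (hin β hβ) (hout β hβ)]
    refine Finset.expect_congr rfl fun z _ => ?_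
    rw [edgeProd_restrict_mul a b β (fun e => a e ∈ S) z]
  · intro h0
    have := congrFun h0 e₀
    simp [restrictIndex, ha₀, he₀] at this

/-- A connected multigraph has at most one more vertex than it has edges. -/
theorem card_reducedSupport_le {V ι : Type*} [Fintype V] [DecidableEq V] [Fintype ι]
    (a b : ι → V) (i j : V) (α : ι → ℕ)
    (hα : ∀ S : Finset V, i ∈ S → (∀ e, α e ≠ 0 → (a e ∈ S ↔ b e ∈ S)) →
      j ∈ S ∧ ∀ e, α e ≠ 0 → a e ∈ S ∧ b e ∈ S) :
    (reducedSupport a b i j α).card ≤ ∑ e, α e := by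
  classical
  set R := reducedSupport a b i j α with hR
  let ext : (R → ℝ) →ₗ[ℝ] (V → ℝ) :=
    { toFun := fun f v => if h : v ∈ R then f ⟨v, h⟩ else 0
      map_add' := fun f g => by ext v; by_cases h : v ∈ R <;> simp [h]
      map_smul' := fun c f => by ext v; by_cases h : v ∈ R <;> simp [h] }
  -- Differences along the edges of functions extended by zero, in particular to i. A function in
  -- the kernel has a zero set containing i that no edge leaves, so it vanishes; comparing
  -- dimensions bounds |R| by the number of distinct edges.
  let L : (R → ℝ) →ₗ[ℝ] ({e // α e ≠ 0} → ℝ) :=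
    LinearMap.pi fun e => ((LinearMap.proj (a e.1) : (V → ℝ) →ₗ[ℝ] ℝ) - LinearMap.proj (b e.1)) ∘ₗ ext
  have hL : Function.Injective L := by
    rw [injective_iff_map_eq_zero]
    intro f hf
    have hclosed : ∀ e, α e ≠ 0 → ext f (a e) = ext f (b e) := fun e he => by
      have := congrFun hf ⟨e, he⟩
      simpa [L, sub_eq_zero] using this
    have hi : i ∉ R := by simp [hR, mem_reducedSupport]
    obtain ⟨hj, hS⟩ := hα (Finset.univ.filter fun v => ext f v = 0) (by simp [ext, hi])
      (fun e he => by simp [hclosed e he])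
    ext ⟨v, hv⟩
    have hv0 : ext f v = 0 := by
      rw [hR, mem_reducedSupport] at hv
      rcases hv.2 with rfl | ⟨e, he, rfl⟩ | ⟨e, he, rfl⟩
      · simpa using hj
      · simpa using (hS e he).1
      · simpa using (hS e he).2
    simpa [ext, hv] using hv0
  have h1 := LinearMap.finrank_le_finrank_of_injective hL
  rw [Module.finrank_fintype_fun_eq_card, Module.finrank_fintype_fun_eq_card, Fintype.card_coe,
    Fintype.card_subtype] at h1
  refine h1.trans ?_
  rw [Finset.card_eq_sum_ones, Finset.sum_filter]
  refine Finset.sum_le_sum fun e _ => ?_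
  split_ifs with h <;> lia

/-- On the event, labels propagate from i to j and along the edges: the set where two such labelings
agree contains both and no edge leaves it. So the labels on the reduced support are determined by
the others. -/
theorem markedEdgeMoment_le {V K ι : Type*} [Fintype V] [DecidableEq V] [Fintype K]
    [DecidableEq K] [Nonempty K] [Fintype ι] (a b : ι → V) (i j : V) (α : ι → ℕ)
    (hα : ∀ S : Finset V, i ∈ S → j ∈ S → (∀ e, α e ≠ 0 → (a e ∈ S ↔ b e ∈ S)) →
      ∀ e, α e ≠ 0 → a e ∈ S ∧ b e ∈ S) :
    markedEdgeMoment K a b i j α ≤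
      ((Fintype.card K : ℝ)⁻¹) ^ (reducedSupport a b i j α).card := by
  classical
  have h1 : markedEdgeMoment K a b i j α =
      𝔼 z : V → K, if z i = z j ∧ ∀ e, α e ≠ 0 → z (a e) = z (b e) then (1 : ℝ) else 0 := by
    refine Finset.expect_congr rfl fun z _ => ?_
    rw [edgeProd_eq_ite]
    split_ifs <;> simp_all
  rw [h1]
  refine expect_indicator_le _ _ fun z z' hz hz' hR => ?_
  have hi : z i = z' i := hR i (by simp [mem_reducedSupport])
  have hj : z j = z' j := by rw [← hz.1, ← hz'.1, hi]
  have hS := hα (Finset.univ.filter fun v => z v = z' v) (by simpa) (by simpa)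
    (fun e he => by simp [hz.2 e he, hz'.2 e he])
  funext v
  by_cases hv : v ∈ reducedSupport a b i j α
  · rw [mem_reducedSupport] at hv
    rcases hv.2 with rfl | ⟨e, he, rfl⟩ | ⟨e, he, rfl⟩
    · exact hj
    · simpa using (hS e he).1
    · simpa using (hS e he).2
  · exact hR v hv

/-- Once the labels of i and of the reduced support of `β` are fixed, the edges of `β` have known
ends and the edges of `α - β` propagate labels to the rest. For β ≤ α the exponent complements the
one for `β`, so that the product of the two bounds has the exponent of `α`. -/
theorem edgeMoment_sub_le {V K ι : Type*} [Fintype V] [DecidableEq V] [Fintype K]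
    [DecidableEq K] [Nonempty K] [Fintype ι] (a b : ι → V) (i j : V) (α β : ι → ℕ)
    (hα : ∀ S : Finset V, i ∈ S → j ∈ S → (∀ e, α e ≠ 0 → (a e ∈ S ↔ b e ∈ S)) →
      ∀ e, α e ≠ 0 → a e ∈ S ∧ b e ∈ S) :
    edgeMoment K a b (α - β) ≤ ((Fintype.card K : ℝ)⁻¹) ^
      (reducedSupport a b i j α \ reducedSupport a b i j β).card := by
  classical
  have h1 : edgeMoment K a b (α - β) =
      𝔼 z : V → K, if ∀ e, (α - β) e ≠ 0 → z (a e) = z (b e) then (1 : ℝ) else 0 :=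
    Finset.expect_congr rfl fun z _ => edgeProd_eq_ite _ _ _ _
  rw [h1]
  refine expect_indicator_le _ _ fun z z' hz hz' hR => ?_
  have hU : ∀ v, (v = i ∨ v ∈ reducedSupport a b i j β) → z v = z' v := by
    intro v hv
    refine hR v ?_
    rcases hv with rfl | hv
    · simp [mem_reducedSupport]
    · simp [hv]
  have hi := hU i (Or.inl rfl)
  have hj : z j = z' j := hU j (by
    by_cases h : j = i
    · exact Or.inl h
    · exact Or.inr (mem_reducedSupport.2 ⟨h, Or.inl rfl⟩))
  have hS := hα (Finset.univ.filter fun v => z v = z' v) (by simpa) (by simpa)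
    (fun e he => by
      by_cases hβ : β e = 0
      · have h0 : (α - β) e ≠ 0 := by simpa [hβ] using he
        simp [hz e h0, hz' e h0]
      · have ha : z (a e) = z' (a e) := hU _ (by
          by_cases h : a e = i
          · exact Or.inl h
          · exact Or.inr (mem_reducedSupport.2 ⟨h, Or.inr (Or.inl ⟨e, hβ, rfl⟩)⟩))
        have hb : z (b e) = z' (b e) := hU _ (by
          by_cases h : b e = i
          · exact Or.inl h
          · exact Or.inr (mem_reducedSupport.2 ⟨h, Or.inr (Or.inr ⟨e, hβ, rfl⟩)⟩))
        simp [ha, hb])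
  funext v
  by_cases hv : v ∈ reducedSupport a b i j α
  · rw [mem_reducedSupport] at hv
    rcases hv.2 with rfl | ⟨e, he, rfl⟩ | ⟨e, he, rfl⟩
    · exact hj
    · simpa using (hS e he).1
    · simpa using (hS e he).2
  · exact hR v (by simp [hv])

theorem edgeMoment_nonneg {V K ι : Type*} [Fintype V] [DecidableEq V] [Fintype K] [DecidableEq K]
    [Fintype ι] (a b : ι → V) (α : ι → ℕ) : 0 ≤ edgeMoment K a b α :=
  Finset.expect_nonneg fun z _ => Finset.prod_nonneg fun e _ => by positivity

theorem markedEdgeMoment_nonneg {V K ι : Type*} [Fintype V] [DecidableEq V] [Fintype K]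
    [DecidableEq K] [Fintype ι] (a b : ι → V) (i j : V) (α : ι → ℕ) :
    0 ≤ markedEdgeMoment K a b i j α :=
  Finset.expect_nonneg fun z _ => mul_nonneg (by positivity)
    (Finset.prod_nonneg fun e _ => by positivity)

/-- The cumulants of the monochromaticity indicators are small. -/
theorem abs_cumulant_le {V K ι : Type*} [Fintype V] [DecidableEq V] [Fintype K]
    [DecidableEq K] [AddCommGroup K] [Fintype ι] [DecidableEq ι] (a b : ι → V) (i j : V)
    (α : ι → ℕ) :
    |cumulant (markedEdgeMoment K a b i j) (edgeMoment K a b) α| ≤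
      ((Fintype.card K : ℝ)⁻¹) ^ (reducedSupport a b i j α).card *
        ((∑ e, α e : ℕ) + 1 : ℝ) ^ (∑ e, α e) := by
  by_cases hκ : cumulant (markedEdgeMoment K a b i j) (edgeMoment K a b) α = 0
  · rw [hκ, abs_zero]
    positivity
  have hconn : ∀ S : Finset V, i ∈ S → j ∈ S → (∀ e, α e ≠ 0 → (a e ∈ S ↔ b e ∈ S)) →
      ∀ e, α e ≠ 0 → a e ∈ S ∧ b e ∈ S := by
    by_cases hα : α = 0
    · intro S _ _ _ e he
      simp [hα] at he
    · intro S hi _ hS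
      exact (mem_of_cumulant_ne_zero a b i j hα hκ S hi hS).2
  set q : ℝ := (Fintype.card K : ℝ)⁻¹ with hq
  set R := reducedSupport a b i j with hR
  have hc := markedEdgeMoment_le (K := K) a b i j α hconn
  by_cases hα : α = 0
  · subst hα
    have : (multiBox (0 : ι → ℕ)).erase 0 = ∅ := by
      ext β; simp only [Finset.mem_erase, mem_multiBox, Finset.notMem_empty, iff_false, not_and]
      exact fun h h' => h (le_antisymm h' fun e => Nat.zero_le _)
    rw [cumulant_eq, this, Finset.sum_empty, sub_zero,
      abs_of_nonneg (markedEdgeMoment_nonneg a b i j 0)]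
    simpa only [Pi.zero_apply, Finset.sum_const_zero, pow_zero, mul_one] using hc
  set d := ∑ e, α e with hd
  have hd1 : 1 ≤ d := by
    obtain ⟨e, he⟩ := Function.ne_iff.1 hα
    exact (Nat.one_le_iff_ne_zero.2 he).trans
      (Finset.single_le_sum (fun _ _ => Nat.zero_le _) (Finset.mem_univ e))
  -- A proper β has |β| + 1 ≤ d, which allows the base d in the inductive bound.
  have hterm : ∀ β ∈ (multiBox α).erase α,
      |(multiChoose α β : ℝ) * cumulant (markedEdgeMoment K a b i j) (edgeMoment K a b) β *
        edgeMoment K a b (α - β)| ≤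
      q ^ (R α).card * ((multiChoose α β : ℝ) * (d : ℝ) ^ (∑ e, β e)) := by
    intro β hβ
    have hlt := sum_lt_sum_of_mem_erase_multiBox hβ
    have hβα : β ≤ α := mem_multiBox.1 (Finset.mem_of_mem_erase hβ)
    have ih := abs_cumulant_le (K := K) a b i j β
    have hm := edgeMoment_sub_le (K := K) a b i j α β hconn
    have hsub : R β ⊆ R α := by
      intro v hv
      rw [hR, mem_reducedSupport] at hv ⊢
      have hne : ∀ e, β e ≠ 0 → α e ≠ 0 := fun e he h0 => he (Nat.le_zero.1 (h0 ▸ hβα e))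
      refine ⟨hv.1, hv.2.imp id (Or.imp ?_ ?_)⟩
      · rintro ⟨e, he, rfl⟩; exact ⟨e, hne e he, rfl⟩
      · rintro ⟨e, he, rfl⟩; exact ⟨e, hne e he, rfl⟩
    rw [abs_mul, abs_mul, Nat.abs_cast, abs_of_nonneg (edgeMoment_nonneg a b _)]
    have hcard : (R α).card = (R β).card + (R α \ R β).card := by
      rw [Finset.card_sdiff_of_subset hsub, Nat.add_sub_cancel' (Finset.card_le_card hsub)]
    have hpow : ((∑ e, β e : ℕ) + 1 : ℝ) ^ (∑ e, β e) ≤ (d : ℝ) ^ (∑ e, β e) := by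
      refine pow_le_pow_left₀ (by positivity) ?_ _
      exact_mod_cast hlt
    calc (multiChoose α β : ℝ) *
          |cumulant (markedEdgeMoment K a b i j) (edgeMoment K a b) β| *
            edgeMoment K a b (α - β)
        ≤ (multiChoose α β : ℝ) * (q ^ (R β).card * (d : ℝ) ^ (∑ e, β e)) *
            q ^ (R α \ R β).card := by
          refine mul_le_mul (mul_le_mul_of_nonneg_left (ih.trans ?_) (by positivity)) hm
            (edgeMoment_nonneg a b _) (by positivity)
          exact mul_le_mul_of_nonneg_left hpow (by positivity)
      _ = _ := by rw [hcard, pow_add]; ring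
  rw [cumulant_eq]
  refine (abs_sub _ _).trans ?_
  rw [abs_of_nonneg (markedEdgeMoment_nonneg a b i j α)]
  have hsum := (Finset.abs_sum_le_sum_abs _ _).trans (Finset.sum_le_sum hterm)
  rw [← Finset.mul_sum] at hsum
  have htot := sum_multiBox_multiChoose_mul_pow α (d : ℝ)
  rw [← Finset.sum_erase_add _ _ (mem_multiBox.2 (le_refl α)), ← hd] at htot
  have hself : multiChoose α α = 1 := by simp [multiChoose]
  rw [hself, Nat.cast_one, one_mul] at htot
  have hdd : (1 : ℝ) ≤ (d : ℝ) ^ d := one_le_pow₀ (by exact_mod_cast hd1)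
  have hq0 : 0 ≤ q ^ (R α).card := by positivity
  -- The omitted β = α term of the binomial sum, d ^ d ≥ 1, pays for the moment `c α`.
  calc _ ≤ q ^ (R α).card + q ^ (R α).card * (((d : ℝ) + 1) ^ d - (d : ℝ) ^ d) := by
        refine add_le_add hc (hsum.trans (le_of_eq ?_))
        rw [← htot]; ring
    _ ≤ _ := by nlinarith
termination_by ∑ e, α e

/-! ### Counting multigraphs. -/

theorem card_piAntidiag_le {ι : Type*} [DecidableEq ι] (E : Finset ι) (d : ℕ) :
    (Finset.piAntidiag E d).card ≤ E.card ^ d := by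
  classical
  induction d with
  | zero => simp
  | succ d ih =>
    have hsub : Finset.piAntidiag E (d + 1) ⊆
        (E ×ˢ Finset.piAntidiag E d).image fun x => x.2 + Pi.single x.1 1 := by
      intro α hα
      rw [Finset.mem_piAntidiag] at hα
      obtain ⟨e, heE, he⟩ : ∃ e ∈ E, α e ≠ 0 := by
        by_contra! h
        rw [Finset.sum_eq_zero h] at hα
        exact absurd hα.1 (by lia)
      have hα' : α - Pi.single e 1 + Pi.single e 1 = α := by
        funext e'
        by_cases h : e' = e
        · subst h; simp; lia
        · simp [h]
      refine Finset.mem_image.2 ⟨(e, α - Pi.single e 1), ?_, hα'⟩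
      rw [Finset.mem_product, Finset.mem_piAntidiag]
      refine ⟨heE, ?_, fun e' he' => hα.2 e' fun h0 => he' (by simp [h0])⟩
      have h1 := hα.1
      rw [← hα'] at h1
      simp only [Pi.add_apply] at h1
      rw [Finset.sum_add_distrib, Finset.sum_pi_single', if_pos heE] at h1
      lia
    refine (Finset.card_le_card hsub).trans (Finset.card_image_le.trans ?_)
    rw [Finset.card_product, pow_succ, mul_comm]
    exact Nat.mul_le_mul_right _ ih

/-- There are at most |V|^v sets of size v, so each of the d sizes contributes at most 1. -/
theorem sum_inv_card_pow_le {V : Type*} [Fintype V] [DecidableEq V] (d : ℕ) :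
    ∑ U : Finset V with U.card < d, ((Fintype.card V : ℝ) ^ U.card)⁻¹ ≤ d := by
  rw [← Finset.sum_fiberwise_of_maps_to (t := Finset.range d) (g := Finset.card)
    (fun U hU => by simpa using hU)]
  calc _ ≤ ∑ v ∈ Finset.range d, (1 : ℝ) := by
        refine Finset.sum_le_sum fun v hv => ?_
        have h1 : ∑ U ∈ (Finset.univ.filter fun U : Finset V => U.card < d) with U.card = v,
            ((Fintype.card V : ℝ) ^ U.card)⁻¹ =
            ∑ U ∈ Finset.powersetCard v (Finset.univ : Finset V),
              ((Fintype.card V : ℝ) ^ v)⁻¹ := by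
          refine Finset.sum_congr ?_ fun U hU => by rw [(Finset.mem_powersetCard.1 hU).2]
          ext U
          simp only [Finset.mem_filter, Finset.mem_univ, true_and, Finset.mem_powersetCard,
            Finset.subset_univ]
          refine ⟨fun h => h.2, fun h => ⟨h ▸ Finset.mem_range.1 hv, h⟩⟩
        rw [h1, Finset.sum_const, Finset.card_powersetCard, nsmul_eq_mul, Finset.card_univ,
          ← div_eq_mul_inv]
        refine div_le_one_of_le₀ ?_ (by positivity)
        exact_mod_cast Nat.choose_le_pow _ _
    _ = d := by simp

/-- The vertices of a multigraph with edges in `Fin n₁ × Fin n₂`, without the marked ones. -/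
def freeVertices {n₁ n₂ : ℕ} (p : Fin n₁) (q : Fin n₂) (α : Fin n₁ × Fin n₂ → ℕ) :
    Finset (Fin n₁ ⊕ Fin n₂) :=
  (reducedSupport (fun e => Sum.inl e.1) (fun e => Sum.inr e.2) (Sum.inl p) (Sum.inr q) α).erase
    (Sum.inr q)

theorem card_freeVertices_add_one {n₁ n₂ : ℕ} (p : Fin n₁) (q : Fin n₂)
    (α : Fin n₁ × Fin n₂ → ℕ) :
    (freeVertices p q α).card + 1 =
      (reducedSupport (fun e => Sum.inl e.1) (fun e => Sum.inr e.2) (Sum.inl p) (Sum.inr q)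
        α).card :=
  Finset.card_erase_add_one (by simp [mem_reducedSupport])

/-- The edges join p and the rows of `U` to q and the columns of `U`. The two sides have at most |U|
+ 2 ≤ 2d vertices together, hence span at most d² pairs, and each of the d edges is one of them. -/
theorem card_filter_freeVertices_le {n₁ n₂ : ℕ} (p : Fin n₁) (q : Fin n₂) (D d : ℕ)
    (U : Finset (Fin n₁ ⊕ Fin n₂)) (hU : U.card < d) :
    ({α ∈ multiIndices (Fin n₁ × Fin n₂) D | ∑ e, α e = d ∧ freeVertices p q α = U}).card ≤
      (d ^ 2) ^ d := by
  set E : Finset (Fin n₁ × Fin n₂) := (insert p U.toLeft) ×ˢ (insert q U.toRight) with hE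
  have hcardE : E.card ≤ d ^ 2 := by
    rw [hE, Finset.card_product]
    have h1 := Finset.card_insert_le p U.toLeft
    have h2 := Finset.card_insert_le q U.toRight
    have h3 := Finset.card_toLeft_add_card_toRight (u := U)
    set A := (insert p U.toLeft).card
    set B := (insert q U.toRight).card
    have h4 : A + B ≤ d + d := by lia
    zify at h4 ⊢
    nlinarith [sq_nonneg ((A : ℤ) - B)]
  refine le_trans (Finset.card_le_card ?_)
    ((card_piAntidiag_le E d).trans (Nat.pow_le_pow_left hcardE d))
  intro α hα
  obtain ⟨-, hd, rfl⟩ := Finset.mem_filter.1 hα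
  have hmem : ∀ e, α e ≠ 0 → e ∈ E := by
    intro e he
    simp only [hE, Finset.mem_product, Finset.mem_insert, Finset.mem_toLeft, Finset.mem_toRight,
      freeVertices, Finset.mem_erase, mem_reducedSupport]
    refine ⟨?_, ?_⟩
    · by_cases h : e.1 = p
      · exact Or.inl h
      · exact Or.inr ⟨by simp, by simpa using h, Or.inr (Or.inl ⟨e, he, rfl⟩)⟩
    · by_cases h : e.2 = q
      · exact Or.inl h
      · exact Or.inr ⟨by simpa using h, by simp, Or.inr (Or.inr ⟨e, he, rfl⟩)⟩
  refine Finset.mem_piAntidiag.2 ⟨?_, hmem⟩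
  rw [← hd]
  exact Finset.sum_subset (Finset.subset_univ _) fun e _ he => by
    by_contra h
    exact he (hmem e h)

theorem sum_inv_card_pow_freeVertices_le {n₁ n₂ : ℕ} (p : Fin n₁) (q : Fin n₂) (D d : ℕ) :
    ∑ α ∈ multiIndices (Fin n₁ × Fin n₂) D with
        ∑ e, α e = d ∧ (freeVertices p q α).card < d,
      (((n₁ : ℝ) + n₂) ^ (freeVertices p q α).card)⁻¹ ≤ d * ((d : ℝ) ^ 2) ^ d := by
  have hV : ((n₁ : ℝ) + n₂) = (Fintype.card (Fin n₁ ⊕ Fin n₂) : ℝ) := by simp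
  rw [hV, ← Finset.sum_fiberwise_of_maps_to
    (t := Finset.univ.filter fun U : Finset (Fin n₁ ⊕ Fin n₂) => U.card < d)
    (g := freeVertices p q) (fun α hα => by simpa using (Finset.mem_filter.1 hα).2.2)]
  refine le_trans ?_ (mul_le_mul_of_nonneg_right
    (sum_inv_card_pow_le (V := Fin n₁ ⊕ Fin n₂) d) (by positivity))
  rw [Finset.sum_mul]
  refine Finset.sum_le_sum fun U hU => ?_
  have hUd : U.card < d := (Finset.mem_filter.1 hU).2
  rw [Finset.sum_congr rfl (g := fun _ => ((Fintype.card (Fin n₁ ⊕ Fin n₂) : ℝ) ^ U.card)⁻¹)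
    (fun α hα => by rw [(Finset.mem_filter.1 hα).2]), Finset.sum_const, nsmul_eq_mul, mul_comm]
  refine mul_le_mul_of_nonneg_left ?_ (by positivity)
  refine le_trans (b := ((({α ∈ multiIndices (Fin n₁ × Fin n₂) D |
    ∑ e, α e = d ∧ freeVertices p q α = U}).card : ℕ) : ℝ)) ?_ ?_
  · refine Nat.cast_le.2 (Finset.card_le_card fun α hα => ?_)
    simp only [Finset.mem_filter] at hα ⊢
    exact ⟨hα.1.1, hα.1.2.1, hα.2⟩
  · exact_mod_cast card_filter_freeVertices_le p q D d U hUd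

/-! ### Summing the squared cumulants. -/

/-- Since q = min(1, k²/n) ≤ 1 and v + 1 ≤ d, q^d ≤ (k²/n)^(v+1), which trades the powers of k in
the cumulant bound for powers of n. The inequality d(d+1) ≤ D(D+1) leaves d^(-2d), which matches the
count of multigraphs. -/
theorem sq_scaled_cumulant_le {n k r lam κ : ℝ} {D d v : ℕ} (hn : 0 < n) (hk : 0 < k) (hr : 0 < r)
    (hSNR : lam ^ 2 ≤ r / ((D : ℝ) * ((D : ℝ) + 1)) ^ 2 * min 1 (k ^ 2 / n))
    (hdD : d ≤ D) (hv : v + 1 ≤ d) (hκ : |κ| ≤ k⁻¹ ^ (v + 1) * ((d : ℝ) + 1) ^ d) :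
    (lam ^ (d + 1) * κ) ^ 2 ≤ lam ^ 2 / n * r ^ d * (((d : ℝ) ^ 2) ^ d)⁻¹ * (n ^ v)⁻¹ := by
  set q := min 1 (k ^ 2 / n) with hq
  have hq0 : 0 < q := lt_min one_pos (by positivity)
  have hd0 : (0 : ℝ) < d := by exact_mod_cast (by lia : 0 < d)
  have hdD' : (d : ℝ) ≤ D := by exact_mod_cast hdD
  have hD0 : (0 : ℝ) < D := hd0.trans_le hdD'
  have hqpow : q ^ d ≤ (k ^ 2 / n) ^ (v + 1) :=
    (pow_le_pow_of_le_one hq0.le (min_le_left _ _) hv).trans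
      (pow_le_pow_left₀ hq0.le (min_le_right _ _) _)
  have hfrac : ((d : ℝ) + 1) ^ 2 / ((D : ℝ) * ((D : ℝ) + 1)) ^ 2 ≤ ((d : ℝ) ^ 2)⁻¹ := by
    rw [← div_pow, ← inv_pow]
    refine pow_le_pow_left₀ (by positivity) ?_ 2
    rw [div_le_iff₀ (by positivity), inv_mul_eq_div, le_div_iff₀ hd0]
    nlinarith
  have h1 : (lam ^ 2) ^ d ≤ r ^ d * ((((D : ℝ) * ((D : ℝ) + 1)) ^ 2)⁻¹) ^ d * q ^ d := by
    rw [← mul_pow, ← mul_pow, ← div_eq_mul_inv]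
    exact pow_le_pow_left₀ (sq_nonneg _) hSNR d
  have h2 : κ ^ 2 ≤ (k⁻¹ ^ 2) ^ (v + 1) * (((d : ℝ) + 1) ^ 2) ^ d := by
    rw [← sq_abs]
    refine (pow_le_pow_left₀ (abs_nonneg _) hκ 2).trans (le_of_eq ?_)
    generalize (d : ℝ) + 1 = x
    ring
  calc (lam ^ (d + 1) * κ) ^ 2 = lam ^ 2 * ((lam ^ 2) ^ d * κ ^ 2) := by ring
    _ ≤ lam ^ 2 * ((r ^ d * ((((D : ℝ) * ((D : ℝ) + 1)) ^ 2)⁻¹) ^ d * (k ^ 2 / n) ^ (v + 1)) *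
          ((k⁻¹ ^ 2) ^ (v + 1) * (((d : ℝ) + 1) ^ 2) ^ d)) := by
        refine mul_le_mul_of_nonneg_left (mul_le_mul (h1.trans ?_) h2 (sq_nonneg _)
          (by positivity)) (sq_nonneg _)
        exact mul_le_mul_of_nonneg_left hqpow (by positivity)
    _ = lam ^ 2 * r ^ d * (((d : ℝ) + 1) ^ 2 / ((D : ℝ) * ((D : ℝ) + 1)) ^ 2) ^ d *
          (n⁻¹) ^ (v + 1) := by
        have : (k ^ 2 / n) ^ (v + 1) * (k⁻¹ ^ 2) ^ (v + 1) = (n⁻¹) ^ (v + 1) := by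
          rw [← mul_pow]; congr 1; field_simp
        rw [← this, div_eq_mul_inv ((((d : ℝ) + 1)) ^ 2), mul_pow _ _ d]
        generalize (((D : ℝ) * ((D : ℝ) + 1)) ^ 2)⁻¹ ^ d = x
        generalize (((d : ℝ) + 1) ^ 2) ^ d = y
        ring
    _ ≤ lam ^ 2 * r ^ d * (((d : ℝ) ^ 2)⁻¹) ^ d * (n⁻¹) ^ (v + 1) := by
        gcongr
    _ = _ := by rw [inv_pow, inv_pow, pow_succ n, mul_inv]; ring

theorem sum_mul_pow_le {r : ℝ} (hr₀ : 0 < r) (hr₁ : r < 1) (D : ℕ) :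
    ∑ d ∈ Finset.range (D + 1), (d : ℝ) * r ^ d ≤ r / (1 - r) ^ 2 := by
  have hr : ‖r‖ < 1 := by rwa [Real.norm_of_nonneg hr₀.le]
  have h := hasSum_coe_mul_geometric_of_norm_lt_one hr
  exact sum_le_hasSum _ (fun _ _ => by positivity) h

/-- The sum of the squared cumulants in the biclustering model. -/
theorem sum_sq_cumulant_le {n₁ n₂ D k : ℕ} [NeZero k] (p : Fin n₁) (q : Fin n₂) {r lam : ℝ}
    (hr₀ : 0 < r) (hr₁ : r < 1)
    (hSNR : lam ^ 2 ≤ r / ((D : ℝ) * ((D : ℝ) + 1)) ^ 2 *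
      min 1 ((k : ℝ) ^ 2 / ((n₁ : ℝ) + (n₂ : ℝ)))) :
    ∑ α ∈ multiIndices (Fin n₁ × Fin n₂) D, (lam ^ (∑ e, α e + 1) *
      cumulant (markedEdgeMoment (Fin k) (fun e : Fin n₁ × Fin n₂ => Sum.inl e.1)
        (fun e => Sum.inr e.2) (Sum.inl p) (Sum.inr q))
        (edgeMoment (Fin k) (fun e => Sum.inl e.1) (fun e => Sum.inr e.2)) α) ^ 2 ≤
      lam ^ 2 / (k : ℝ) ^ 2 + r * (2 - r) * lam ^ 2 / ((1 - r) ^ 2 * ((n₁ : ℝ) + (n₂ : ℝ))) := by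
  have hk : (0 : ℝ) < k := by exact_mod_cast Nat.pos_of_ne_zero (NeZero.ne k)
  have hn : (0 : ℝ) < (n₁ : ℝ) + n₂ := by
    have : (0 : ℝ) < n₁ := by exact_mod_cast p.pos
    positivity
  set κ := cumulant (markedEdgeMoment (Fin k) (fun e : Fin n₁ × Fin n₂ => Sum.inl e.1)
        (fun e => Sum.inr e.2) (Sum.inl p) (Sum.inr q))
        (edgeMoment (Fin k) (fun e => Sum.inl e.1) (fun e => Sum.inr e.2)) with hκ
  have habs : ∀ α, |κ α| ≤ (k : ℝ)⁻¹ ^ ((freeVertices p q α).card + 1) *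
      ((∑ e, α e : ℕ) + 1 : ℝ) ^ (∑ e, α e) := by
    intro α
    have := abs_cumulant_le (K := Fin k) (fun e : Fin n₁ × Fin n₂ => Sum.inl e.1)
      (fun e => Sum.inr e.2) (Sum.inl p) (Sum.inr q) α
    rwa [← card_freeVertices_add_one, Fintype.card_fin] at this
  have hlt : ∀ α, α ≠ 0 → κ α ≠ 0 → (freeVertices p q α).card < ∑ e, α e := by
    intro α hα h
    have := card_reducedSupport_le _ _ _ _ α fun S hi hS =>
      mem_of_cumulant_ne_zero _ _ _ _ hα h S hi hS
    rw [← card_freeVertices_add_one] at this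
    exact this
  have hzero : ∀ α : Fin n₁ × Fin n₂ → ℕ, ∑ e, α e = 0 → α = 0 := fun α h => by
    funext e
    simpa using (Finset.sum_eq_zero_iff.1 h) e (Finset.mem_univ e)
  have hdeg : ∀ d ∈ Finset.range (D + 1),
      ∑ α ∈ multiIndices (Fin n₁ × Fin n₂) D with ∑ e, α e = d,
        (lam ^ (∑ e, α e + 1) * κ α) ^ 2 ≤
      (if d = 0 then lam ^ 2 / (k : ℝ) ^ 2 else 0) +
        lam ^ 2 / ((n₁ : ℝ) + n₂) * (d * r ^ d) := by
    intro d hd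
    have hdD : d ≤ D := Nat.lt_succ_iff.1 (Finset.mem_range.1 hd)
    by_cases hd0 : d = 0
    · subst hd0
      have hf : (multiIndices (Fin n₁ × Fin n₂) D).filter (fun α => ∑ e, α e = 0) = {0} := by
        ext α
        simp only [Finset.mem_filter, mem_multiIndices, Finset.mem_singleton]
        refine ⟨fun h => hzero α h.2, ?_⟩
        rintro rfl
        simp
      rw [hf, Finset.sum_singleton]
      have h0 := habs 0
      have hfree : freeVertices p q (0 : Fin n₁ × Fin n₂ → ℕ) = ∅ := by
        ext v
        simp [freeVertices, mem_reducedSupport]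
        tauto
      rw [hfree] at h0
      simp only [Finset.card_empty, zero_add, pow_one, Pi.zero_apply, Finset.sum_const_zero,
        pow_zero, mul_one] at h0
      simp only [Pi.zero_apply, Finset.sum_const_zero, zero_add, pow_one, if_true, Nat.cast_zero,
        zero_mul, mul_zero, add_zero]
      rw [mul_pow, div_eq_mul_inv, ← inv_pow, ← sq_abs (κ 0)]
      gcongr
    · rw [if_neg hd0, zero_add]
      have hsub : ∑ α ∈ multiIndices (Fin n₁ × Fin n₂) D with ∑ e, α e = d,
          (lam ^ (∑ e, α e + 1) * κ α) ^ 2 =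
          ∑ α ∈ multiIndices (Fin n₁ × Fin n₂) D with
            ∑ e, α e = d ∧ (freeVertices p q α).card < d,
          (lam ^ (∑ e, α e + 1) * κ α) ^ 2 := by
        symm
        refine Finset.sum_subset (fun α hα => ?_) fun α hα hα' => ?_
        · simp only [Finset.mem_filter] at hα ⊢
          exact ⟨hα.1, hα.2.1⟩
        · simp only [Finset.mem_filter] at hα hα'
          have h0 : κ α = 0 := by
            by_contra h
            refine hα' ⟨hα.1, hα.2, hα.2 ▸ hlt α ?_ h⟩
            rintro rfl
            exact hd0 (by simpa using hα.2.symm)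
          simp [h0]
      rw [hsub]
      have hd0' : (0 : ℝ) < d := by exact_mod_cast Nat.pos_of_ne_zero hd0
      calc _ ≤ ∑ α ∈ multiIndices (Fin n₁ × Fin n₂) D with
            ∑ e, α e = d ∧ (freeVertices p q α).card < d,
            lam ^ 2 / ((n₁ : ℝ) + n₂) * r ^ d * (((d : ℝ) ^ 2) ^ d)⁻¹ *
              (((n₁ : ℝ) + n₂) ^ (freeVertices p q α).card)⁻¹ := by
            refine Finset.sum_le_sum fun α hα => ?_
            simp only [Finset.mem_filter] at hα
            have h1 := habs α
            rw [hα.2.1] at h1 ⊢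
            exact sq_scaled_cumulant_le hn hk hr₀ hSNR hdD hα.2.2 h1
        _ ≤ lam ^ 2 / ((n₁ : ℝ) + n₂) * r ^ d * (((d : ℝ) ^ 2) ^ d)⁻¹ *
              (d * ((d : ℝ) ^ 2) ^ d) := by
            rw [← Finset.mul_sum]
            exact mul_le_mul_of_nonneg_left (sum_inv_card_pow_freeVertices_le p q D d)
              (by positivity)
        _ = _ := by field_simp
  rw [← Finset.sum_fiberwise_of_maps_to (t := Finset.range (D + 1)) (g := fun α => ∑ e, α e)
    (fun α hα => by simpa [Nat.lt_succ_iff] using hα)]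
  refine (Finset.sum_le_sum hdeg).trans ?_
  rw [Finset.sum_add_distrib, Finset.sum_ite_eq' (Finset.range (D + 1)) 0, if_pos (by simp),
    ← Finset.mul_sum]
  refine add_le_add_right ?_ _
  have h1r : 0 < 1 - r := by linarith
  calc _ ≤ lam ^ 2 / ((n₁ : ℝ) + n₂) * (r / (1 - r) ^ 2) :=
        mul_le_mul_of_nonneg_left (sum_mul_pow_le hr₀ hr₁ D) (by positivity)
    -- The series gives r/(1-r)²; the factor 2 - r ≥ 1 of the target is slack.
    _ = r * 1 * lam ^ 2 / ((1 - r) ^ 2 * ((n₁ : ℝ) + n₂)) := by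
        field_simp
    _ ≤ _ := by
        gcongr
        linarith

/-! ### From the Bayes risk to single entries, and conclusion. -/

theorem integrable_eval_pi_gaussianReal {ι : Type*} [Fintype ι] (Q : MvPolynomial ι ℝ) :
    Integrable (fun z => MvPolynomial.eval z Q) (Measure.pi fun _ : ι => gaussianReal 0 1) := by
  classical
  obtain ⟨c, hc⟩ := exists_eval_eq_sum_multiHermite Q le_rfl
  simp_rw [hc]
  refine integrable_finsetSum _ fun α _ => Integrable.const_mul ?_ _
  exact (integrable_multiHermite_mul α 0).congr
    (ae_of_all _ fun z => by simp [multiHermite_zero])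

theorem integrable_sq_eval_add_sub {ι : Type*} [Fintype ι] (P : MvPolynomial ι ℝ) (x : ι → ℝ)
    (t : ℝ) : Integrable (fun z => (MvPolynomial.eval (x + z) P - t) ^ 2)
      (Measure.pi fun _ : ι => gaussianReal 0 1) := by
  refine (integrable_eval_pi_gaussianReal
    ((MvPolynomial.bind₁ (fun e => MvPolynomial.C (x e) + MvPolynomial.X e) P -
      MvPolynomial.C t) ^ 2)).congr (ae_of_all _ fun z => ?_)
  have h : MvPolynomial.eval z
      (MvPolynomial.bind₁ (fun e => MvPolynomial.C (x e) + MvPolynomial.X e) P) =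
      MvPolynomial.eval (x + z) P := by
    rw [← MvPolynomial.coe_aeval_eq_eval, ← MvPolynomial.coe_aeval_eq_eval, RingHom.coe_coe,
      RingHom.coe_coe, MvPolynomial.aeval_bind₁]
    congr 2
    funext e
    simp
  simp [h]

theorem integral_labelLaw {n₁ n₂ k₁ k₂ : ℕ} [NeZero (min k₁ k₂)]
    (F : (Fin n₁ → Fin (min k₁ k₂)) × (Fin n₂ → Fin (min k₁ k₂)) → ℝ) :
    ∫ z, F z ∂labelLaw n₁ n₂ k₁ k₂ = 𝔼 z, F z := by
  have hprob : IsProbabilityMeasure (unifLabel (min k₁ k₂)) := by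
    unfold unifLabel; infer_instance
  have hfin : IsFiniteMeasure (labelLaw n₁ n₂ k₁ k₂) := by
    unfold labelLaw; infer_instance
  have hunif : ∀ c, unifLabel (min k₁ k₂) {c} = ((min k₁ k₂ : ℕ) : ENNReal)⁻¹ := by
    intro c
    rw [unifLabel, uniformOn_univ, Measure.count_singleton, Fintype.card_fin, one_div]
  rw [integral_fintype (Integrable.of_finite), Fintype.expect_eq_sum_div_card, Finset.sum_div]
  refine Finset.sum_congr rfl fun z _ => ?_
  rw [smul_eq_mul, mul_comm, div_eq_mul_inv]
  congr 1
  rw [measureReal_def, labelLaw, ← Prod.mk.eta (p := z),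
    ← Set.singleton_prod_singleton, Measure.prod_prod, Measure.pi_singleton, Measure.pi_singleton]
  simp [hunif, mul_comm]

theorem bayesRisk_eq {n₁ n₂ D k₁ k₂ : ℕ} [NeZero (min k₁ k₂)] (lam : ℝ)
    (P : LowDegEstimator n₁ n₂ D) :
    _root_.bayesRisk k₁ k₂ lam P = 1 / ((n₁ : ℝ) * n₂) * ∑ i, ∑ j,
      𝔼 z : (Fin n₁ → Fin (min k₁ k₂)) × (Fin n₂ → Fin (min k₁ k₂)),
        ∫ E, (MvPolynomial.eval (signal lam z + E) (P.1 (i, j)) - signal lam z (i, j)) ^ 2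
          ∂(Measure.pi fun _ : Fin n₁ × Fin n₂ => gaussianReal 0 1) := by
  have hprob : IsProbabilityMeasure (unifLabel (min k₁ k₂)) := by
    unfold unifLabel; infer_instance
  have hfin : IsFiniteMeasure (labelLaw n₁ n₂ k₁ k₂) := by
    unfold labelLaw; infer_instance
  have hnoise : IsProbabilityMeasure (noiseLaw n₁ n₂) := by
    unfold noiseLaw; infer_instance
  have hcont : Continuous fun ME : RealMat n₁ n₂ × RealMat n₁ n₂ =>
      loss (P.estimate (ME.1 + ME.2)) ME.1 := by
    unfold loss LowDegEstimator.estimate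
    refine continuous_const.mul (continuous_finsetSum _ fun i _ => continuous_finsetSum _
      fun j _ => ((((MvPolynomial.continuous_eval (P.1 (i, j))).comp
        (continuous_fst.add continuous_snd))).sub
          ((continuous_apply (i, j)).comp continuous_fst)).pow 2)
  have hsig : Measurable (signal lam : (Fin n₁ → Fin (min k₁ k₂)) × (Fin n₂ → Fin (min k₁ k₂)) →
      RealMat n₁ n₂) := measurable_of_finite _
  have hslice : ∀ z : (Fin n₁ → Fin (min k₁ k₂)) × (Fin n₂ → Fin (min k₁ k₂)),
      Integrable (fun E => loss (P.estimate (signal lam z + E)) (signal lam z))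
        (Measure.pi fun _ : Fin n₁ × Fin n₂ => gaussianReal 0 1) := fun z =>
    (integrable_finsetSum _ fun i _ => integrable_finsetSum _ fun j _ =>
      integrable_sq_eval_add_sub (P.1 (i, j)) (signal lam z) (signal lam z (i, j))).const_mul _
  have hmeas : Measurable (Prod.map (signal lam) id :
      ((Fin n₁ → Fin (min k₁ k₂)) × (Fin n₂ → Fin (min k₁ k₂))) × RealMat n₁ n₂ →
        RealMat n₁ n₂ × RealMat n₁ n₂) := hsig.prodMap measurable_id
  have hprod : (biclusterPrior n₁ n₂ k₁ k₂ lam).prod (noiseLaw n₁ n₂) =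
      ((labelLaw n₁ n₂ k₁ k₂).prod (noiseLaw n₁ n₂)).map (Prod.map (signal lam) id) := by
    unfold biclusterPrior
    rw [← Measure.map_prod_map _ _ hsig measurable_id, Measure.map_id]
  unfold _root_.bayesRisk
  rw [hprod, integral_map hmeas.aemeasurable hcont.aestronglyMeasurable, integral_prod]
  · simp only [Prod.map_fst, Prod.map_snd, id_eq]
    rw [integral_labelLaw]
    unfold loss LowDegEstimator.estimate noiseLaw
    simp_rw [integral_const_mul]
    rw [← Finset.mul_expect]
    congr 1
    simp_rw [← Finset.expect_sum_comm]
    refine Finset.expect_congr rfl fun z _ => ?_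
    rw [integral_finsetSum _ fun i _ => integrable_finsetSum _ fun j _ =>
      integrable_sq_eval_add_sub (P.1 (i, j)) (signal lam z) (signal lam z (i, j))]
    refine Finset.sum_congr rfl fun i _ => ?_
    rw [integral_finsetSum _ fun j _ =>
      integrable_sq_eval_add_sub (P.1 (i, j)) (signal lam z) (signal lam z (i, j))]
  · rw [integrable_prod_iff (hcont.comp_stronglyMeasurable
      hmeas.stronglyMeasurable).aestronglyMeasurable]
    exact ⟨ae_of_all _ fun z => hslice z, Integrable.of_finite⟩

/-- The low-degree lower bound for the estimation of one entry of the signal matrix. -/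
theorem le_entry_risk {n₁ n₂ D k : ℕ} [NeZero k] (p : Fin n₁) (q : Fin n₂) {r lam : ℝ}
    (hr₀ : 0 < r) (hr₁ : r < 1)
    (hSNR : lam ^ 2 ≤ r / ((D : ℝ) * ((D : ℝ) + 1)) ^ 2 *
      min 1 ((k : ℝ) ^ 2 / ((n₁ : ℝ) + (n₂ : ℝ))))
    (P : MvPolynomial (Fin n₁ × Fin n₂) ℝ) (hP : P.totalDegree ≤ D) :
    lam ^ 2 / k - (lam ^ 2 / (k : ℝ) ^ 2 +
        r * (2 - r) * lam ^ 2 / ((1 - r) ^ 2 * ((n₁ : ℝ) + (n₂ : ℝ)))) ≤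
      𝔼 z : (Fin n₁ → Fin k) × (Fin n₂ → Fin k),
        ∫ E, (MvPolynomial.eval (signal lam z + E) P - signal lam z (p, q)) ^ 2
          ∂(Measure.pi fun _ : Fin n₁ × Fin n₂ => gaussianReal 0 1) := by
  set a : Fin n₁ × Fin n₂ → Fin n₁ ⊕ Fin n₂ := fun e => Sum.inl e.1 with ha
  set b : Fin n₁ × Fin n₂ → Fin n₁ ⊕ Fin n₂ := fun e => Sum.inr e.2 with hb
  let X : (Fin n₁ ⊕ Fin n₂ → Fin k) → Fin n₁ × Fin n₂ → ℝ := fun z e =>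
    lam * if z (a e) = z (b e) then 1 else 0
  have hX : ∀ (z : Fin n₁ ⊕ Fin n₂ → Fin k) (γ : Fin n₁ × Fin n₂ → ℕ),
      ∏ e, X z e ^ γ e = lam ^ (∑ e, γ e) * edgeProd a b γ z := by
    intro z γ
    simp only [X, mul_pow, Finset.prod_mul_distrib, Finset.prod_pow_eq_pow_sum]
    rfl
  set c := markedEdgeMoment (Fin k) a b (Sum.inl p) (Sum.inr q) with hc
  set m := edgeMoment (Fin k) a b with hm
  have hmX : ∀ γ, 𝔼 z, ∏ e, X z e ^ γ e = lam ^ (∑ e, γ e) * m γ := by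
    intro γ
    simp_rw [hX]
    rw [← Finset.mul_expect]
    rfl
  have hcX : ∀ γ, 𝔼 z, X z (p, q) * ∏ e, X z e ^ γ e = lam ^ (∑ e, γ e + 1) * c γ := by
    intro γ
    simp_rw [hX, hc, markedEdgeMoment, Finset.mul_expect]
    refine Finset.expect_congr rfl fun z _ => ?_
    simp only [X, ha, hb]
    ring
  -- Two distinct vertices share a label with probability 1/k: the shift lemma with the constant
  -- function 1.
  have hsq : 𝔼 z, X z (p, q) ^ 2 = lam ^ 2 / k := by
    have h := expect_eq_mul_of_shift (K := Fin k) (i := (Sum.inl p : Fin n₁ ⊕ Fin n₂))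
      (j := Sum.inr q) {Sum.inl p} (by simp) (by simp) (fun _ => 1) (fun _ _ => rfl)
    rw [Fintype.expect_const, mul_one, Fintype.card_fin] at h
    rw [div_eq_mul_inv, ← h, Finset.mul_expect]
    refine Finset.expect_congr rfl fun z _ => ?_
    simp only [X, ha, hb]
    split_ifs <;> ring
  have key := le_expect_integral_sq_of_cumulants X (fun z => X z (p, q))
    (fun α => lam ^ (∑ e, α e + 1) * cumulant c m α) (fun α => by
      rw [hcX, ← sum_multiBox_cumulant (fun α => lam ^ (∑ e, α e + 1) * c α)
        (fun α => lam ^ (∑ e, α e) * m α) (by simp [hm, edgeMoment_zero]) α]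
      refine Finset.sum_congr rfl fun β _ => ?_
      rw [cumulant_scale, ← hmX]
      rfl) P hP
  have hsum := sum_sq_cumulant_le (D := D) (k := k) p q hr₀ hr₁ hSNR
  have heq : (𝔼 z : (Fin n₁ → Fin k) × (Fin n₂ → Fin k),
      ∫ E, (MvPolynomial.eval (signal lam z + E) P - signal lam z (p, q)) ^ 2
        ∂(Measure.pi fun _ : Fin n₁ × Fin n₂ => gaussianReal 0 1)) =
      𝔼 z, ∫ E, (MvPolynomial.eval (X z + E) P - X z (p, q)) ^ 2
        ∂(Measure.pi fun _ : Fin n₁ × Fin n₂ => gaussianReal 0 1) := by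
    -- The two label vectors are glued into one labeling of the vertex set of the bipartite graph.
    refine (Fintype.expect_equiv (Equiv.sumArrowEquivProdArrow (Fin n₁) (Fin n₂) (Fin k)) _ _
      fun z => ?_).symm
    have h : signal lam (Equiv.sumArrowEquivProdArrow (Fin n₁) (Fin n₂) (Fin k) z) = X z := by
      funext e
      simp only [X, ha, hb, mul_ite, mul_one, mul_zero]
      rfl
    rw [h]
  rw [heq]
  rw [hsq] at key
  exact (sub_le_sub_left hsum _).trans key

theorem theorem6 (n₁ n₂ k₁ k₂ D : ℕ) (hn₁ : 1 ≤ n₁) (hn₂ : 1 ≤ n₂) (hk₁ : 1 ≤ k₁) (hk₂ : 1 ≤ k₂)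
    (hD : 1 ≤ D) (r lam : ℝ) (hr₀ : 0 < r) (hr₁ : r < 1)
    (hSNR : lam ^ 2 ≤ r / ((D : ℝ) * ((D : ℝ) + 1)) ^ 2 *
      min 1 (min ((k₁ : ℝ) ^ 2) ((k₂ : ℝ) ^ 2) / ((n₁ : ℝ) + (n₂ : ℝ)))) :
    lam ^ 2 / min (k₁ : ℝ) (k₂ : ℝ) -
        (lam ^ 2 / min ((k₁ : ℝ) ^ 2) ((k₂ : ℝ) ^ 2) +
          r * (2 - r) * lam ^ 2 / ((1 - r) ^ 2 * ((n₁ : ℝ) + (n₂ : ℝ)))) ≤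
      lowDegBayesRisk n₁ n₂ k₁ k₂ D lam := by
  have hk : NeZero (min k₁ k₂) := ⟨(lt_min hk₁ hk₂).ne'⟩
  have hmin : min (k₁ : ℝ) (k₂ : ℝ) = ((min k₁ k₂ : ℕ) : ℝ) := by push_cast; rfl
  have hmin2 : min ((k₁ : ℝ) ^ 2) ((k₂ : ℝ) ^ 2) = ((min k₁ k₂ : ℕ) : ℝ) ^ 2 := by
    rcases le_total k₁ k₂ with h | h
    · have h' : (k₁ : ℝ) ≤ k₂ := by exact_mod_cast h
      rw [min_eq_left h, min_eq_left (pow_le_pow_left₀ (by positivity) h' 2)]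
    · have h' : (k₂ : ℝ) ≤ k₁ := by exact_mod_cast h
      rw [min_eq_right h, min_eq_right (pow_le_pow_left₀ (by positivity) h' 2)]
  rw [hmin2] at hSNR ⊢
  rw [hmin]
  refine le_ciInf fun P => ?_
  rw [bayesRisk_eq]
  have hN₁ : (0 : ℝ) < n₁ := by exact_mod_cast hn₁
  have hN₂ : (0 : ℝ) < n₂ := by exact_mod_cast hn₂
  rw [one_div, inv_mul_eq_div, le_div_iff₀ (by positivity)]
  refine le_trans (le_of_eq ?_) (Finset.sum_le_sum fun i _ => Finset.sum_le_sum fun j _ =>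
    le_entry_risk (k := min k₁ k₂) i j hr₀ hr₁ hSNR (P.1 (i, j)) (P.2 (i, j)))
  simp only [Finset.sum_const, Finset.card_univ, Fintype.card_fin, nsmul_eq_mul]
  ring
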